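/- Let $L=\{l_1,\dots,l_n\}$, $n\ge 3$, be $n$ parallel closed line segments in the plane, of arbitrary (possibly zero) lengths, each given by the coordinates of its two endpoints. The problem MaxMaxArea asks to choose points $p_i\in l_i$ $(1\le i\le n)$ such that the largest area of a triangle $p_ip_jp_k$ with pairwise distinct $i,j,k$ is as large as possible; equivalently, to find a triangle of largest area (possibly degenerate) whose three vertices lie on three different segments of $L$. Theorem. MaxMaxArea can be solved in $O(n^2)$ time. That is, on the real RAM (a unit-cost random access machine with exact real arithmetic $+,-,\times,/$ and comparisons) there are a single program and a constant $C$ such that, for every $n\ge 3$ and every family $L$ of $n$ parallel segments, the program halts after at most $Cn^2$ steps and outputs the largest possible area together with three points, lying on three different segments of $L$, that span a triangle of this area. -/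

import Mathlib

/-! ## Parallel segments and the problem MaxMaxArea -/

/-- A closed line segment of the plane, given by its two endpoints (in either order; the two
endpoints may coincide). -/
structure Seg where
  p : ℝ × ℝ
  q : ℝ × ℝ

/-- The set of points of a segment. -/
def Seg.carrier (l : Seg) : Set (ℝ × ℝ) := segment ℝ l.p l.q

/-- All segments of the family are parallel to one common direction `v ≠ 0`. -/
def ParallelFamily {n : ℕ} (L : Fin n → Seg) : Prop :=
  ∃ v : ℝ × ℝ, v ≠ 0 ∧ ∀ i, ∃ c : ℝ, (L i).q - (L i).p = c • v

/-- The area of the (possibly degenerate) triangle `abc`. -/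
noncomputable def triArea (a b c : ℝ × ℝ) : ℝ :=
  |(b.1 - a.1) * (c.2 - a.2) - (c.1 - a.1) * (b.2 - a.2)| / 2

/-- A placement of the imprecise points: one point on every segment. -/
def IsPlacement {n : ℕ} (L : Fin n → Seg) (P : Fin n → ℝ × ℝ) : Prop :=
  ∀ i, P i ∈ (L i).carrier

/-- `A` is the area of a largest-area triangle with corners at three different points of `P`. -/
def IsLargestTriangleArea {n : ℕ} (P : Fin n → ℝ × ℝ) (A : ℝ) : Prop :=
  IsGreatest {B : ℝ | ∃ i j k : Fin n, i ≠ j ∧ i ≠ k ∧ j ≠ k ∧ B = triArea (P i) (P j) (P k)} A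

/-- `A` is the value of MaxMaxArea on `L`: the largest possible area, over all placements, of the
largest-area triangle of the placement. -/
def IsMaxMaxArea {n : ℕ} (L : Fin n → Seg) (A : ℝ) : Prop :=
  IsGreatest {B : ℝ | ∃ P : Fin n → ℝ × ℝ, IsPlacement L P ∧ IsLargestTriangleArea P B} A

/-! ## The real RAM

A unit-cost random access machine with exact real arithmetic, programmed by while programs. It has
integer variables and integer arrays (used for counting and addressing; only `+` and truncated `-`),
and real variables and real arrays (`+`, `-`, `*`, `/` and comparison; no rounding and no conversion
between reals and integers). Variables and arrays are named by literals, so that a program uses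
finitely many of them; array entries are addressed by computed integers. -/

namespace RealRAM

/-- The memory: integer variables, real variables, integer arrays, real arrays. -/
structure State where
  ivar : ℕ → ℕ
  rvar : ℕ → ℝ
  iarr : ℕ → ℕ → ℕ
  rarr : ℕ → ℕ → ℝ

/-- Integer expressions. -/
inductive IExpr where
  | const (k : ℕ)
  | var (x : ℕ)
  | get (a : ℕ) (i : IExpr)
  | add (e f : IExpr)
  | sub (e f : IExpr)

/-- Real expressions; the only constants are integers. -/
inductive RExpr where
  | const (k : ℤ)
  | var (x : ℕ)
  | get (a : ℕ) (i : IExpr)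
  | add (e f : RExpr)
  | sub (e f : RExpr)
  | mul (e f : RExpr)
  | div (e f : RExpr)

/-- Tests. -/
inductive Test where
  | ilt (e f : IExpr)
  | rlt (e f : RExpr)
  | neg (b : Test)
  | conj (b c : Test)

/-- Programs. -/
inductive Cmd where
  | skip
  | setI (x : ℕ) (e : IExpr)
  | setR (x : ℕ) (e : RExpr)
  | putI (a : ℕ) (i : IExpr) (e : IExpr)
  | putR (a : ℕ) (i : IExpr) (e : RExpr)
  | seq (c d : Cmd)
  | cond (b : Test) (c d : Cmd)
  | loop (b : Test) (c : Cmd)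

def IExpr.eval (s : State) : IExpr → ℕ
  | const k => k
  | var x => s.ivar x
  | get a i => s.iarr a (i.eval s)
  | add e f => e.eval s + f.eval s
  | sub e f => e.eval s - f.eval s

/-- The number of operations (constants, memory accesses, arithmetic) in an expression. -/
def IExpr.cost : IExpr → ℕ
  | const _ => 1
  | var _ => 1
  | get _ i => i.cost + 1
  | add e f => e.cost + f.cost + 1
  | sub e f => e.cost + f.cost + 1

noncomputable def RExpr.eval (s : State) : RExpr → ℝ
  | const k => (k : ℝ)
  | var x => s.rvar x
  | get a i => s.rarr a (i.eval s)
  | add e f => e.eval s + f.eval s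
  | sub e f => e.eval s - f.eval s
  | mul e f => e.eval s * f.eval s
  | div e f => e.eval s / f.eval s

def RExpr.cost : RExpr → ℕ
  | const _ => 1
  | var _ => 1
  | get _ i => i.cost + 1
  | add e f => e.cost + f.cost + 1
  | sub e f => e.cost + f.cost + 1
  | mul e f => e.cost + f.cost + 1
  | div e f => e.cost + f.cost + 1

def Test.eval (s : State) : Test → Prop
  | ilt e f => e.eval s < f.eval s
  | rlt e f => e.eval s < f.eval s
  | neg b => ¬ b.eval s
  | conj b c => b.eval s ∧ c.eval s

def Test.cost : Test → ℕ
  | ilt e f => e.cost + f.cost + 1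
  | rlt e f => e.cost + f.cost + 1
  | neg b => b.cost + 1
  | conj b c => b.cost + c.cost + 1

def State.setI (s : State) (x v : ℕ) : State :=
  { s with ivar := Function.update s.ivar x v }

def State.setR (s : State) (x : ℕ) (v : ℝ) : State :=
  { s with rvar := Function.update s.rvar x v }

def State.putI (s : State) (a i v : ℕ) : State :=
  { s with iarr := Function.update s.iarr a (Function.update (s.iarr a) i v) }

def State.putR (s : State) (a i : ℕ) (v : ℝ) : State :=
  { s with rarr := Function.update s.rarr a (Function.update (s.rarr a) i v) }

/-- `Exec c s t s'`: the program `c`, started in the memory state `s`, halts after `t` steps in the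
memory state `s'`. Every operation, assignment and branching counts as a step. -/
inductive Exec : Cmd → State → ℕ → State → Prop
  | skip (s : State) : Exec Cmd.skip s 1 s
  | setI (s : State) (x : ℕ) (e : IExpr) :
      Exec (Cmd.setI x e) s (e.cost + 1) (s.setI x (e.eval s))
  | setR (s : State) (x : ℕ) (e : RExpr) :
      Exec (Cmd.setR x e) s (e.cost + 1) (s.setR x (e.eval s))
  | putI (s : State) (a : ℕ) (i e : IExpr) :
      Exec (Cmd.putI a i e) s (i.cost + e.cost + 1) (s.putI a (i.eval s) (e.eval s))
  | putR (s : State) (a : ℕ) (i : IExpr) (e : RExpr) :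
      Exec (Cmd.putR a i e) s (i.cost + e.cost + 1) (s.putR a (i.eval s) (e.eval s))
  | seq {c d : Cmd} {s s' s'' : State} {t t' : ℕ} :
      Exec c s t s' → Exec d s' t' s'' → Exec (Cmd.seq c d) s (t + t') s''
  | cond_true {b : Test} {c d : Cmd} {s s' : State} {t : ℕ} :
      b.eval s → Exec c s t s' → Exec (Cmd.cond b c d) s (b.cost + 1 + t) s'
  | cond_false {b : Test} {c d : Cmd} {s s' : State} {t : ℕ} :
      ¬ b.eval s → Exec d s t s' → Exec (Cmd.cond b c d) s (b.cost + 1 + t) s'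
  | loop_true {b : Test} {c : Cmd} {s s' s'' : State} {t t' : ℕ} :
      b.eval s → Exec c s t s' → Exec (Cmd.loop b c) s' t' s'' →
      Exec (Cmd.loop b c) s (b.cost + 1 + t + t') s''
  | loop_false {b : Test} {c : Cmd} {s : State} :
      ¬ b.eval s → Exec (Cmd.loop b c) s (b.cost + 1) s

/-- The machine is deterministic: a program has at most one halting run from a given state. -/
theorem Exec.unique {c : Cmd} {s s₁ s₂ : State} {t₁ t₂ : ℕ}
    (h₁ : Exec c s t₁ s₁) (h₂ : Exec c s t₂ s₂) : t₁ = t₂ ∧ s₁ = s₂ := by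
  induction h₁ generalizing t₂ s₂ with
  | skip | setI | setR | putI | putR => cases h₂; exact ⟨rfl, rfl⟩
  | seq _ _ ih ih' =>
    cases h₂ with
    | seq k k' =>
      obtain ⟨rfl, rfl⟩ := ih k
      obtain ⟨rfl, rfl⟩ := ih' k'
      exact ⟨rfl, rfl⟩
  | cond_true hb _ ih =>
    cases h₂ with
    | cond_true _ k => obtain ⟨rfl, rfl⟩ := ih k; exact ⟨rfl, rfl⟩
    | cond_false hb' _ => exact absurd hb hb'
  | cond_false hb _ ih =>
    cases h₂ with
    | cond_true hb' _ => exact absurd hb' hb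
    | cond_false _ k => obtain ⟨rfl, rfl⟩ := ih k; exact ⟨rfl, rfl⟩
  | loop_true hb _ _ ih ih' =>
    cases h₂ with
    | loop_true _ k k' =>
      obtain ⟨rfl, rfl⟩ := ih k
      obtain ⟨rfl, rfl⟩ := ih' k'
      exact ⟨rfl, rfl⟩
    | loop_false hb' => exact absurd hb hb'
  | loop_false hb =>
    cases h₂ with
    | loop_true hb' _ _ => exact absurd hb' hb
    | loop_false _ => exact ⟨rfl, rfl⟩

end RealRAM

/-! ## Input and output of a program for MaxMaxArea -/

/-- The initial memory for the input `L`: integer variable `0` holds the number `n` of segments, the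
real arrays `0, 1, 2, 3` hold the coordinates of the endpoints in the given order of the segments,
and all the rest is `0`. -/
noncomputable def inputState {n : ℕ} (L : Fin n → Seg) : RealRAM.State where
  ivar x := if x = 0 then n else 0
  rvar _ := 0
  iarr _ _ := 0
  rarr a i :=
    if h : i < n then
      match a with
      | 0 => (L ⟨i, h⟩).p.1
      | 1 => (L ⟨i, h⟩).p.2
      | 2 => (L ⟨i, h⟩).q.1
      | 3 => (L ⟨i, h⟩).q.2
      | _ => 0
    else 0

/-- The final memory `s` holds a solution of MaxMaxArea on `L`: real variable `0` holds the largest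
possible area, and a true triangle of this area is given by the indices of three different segments
in the integer variables `0, 1, 2` and by one point on each of them, in the real variables
`1, 2`, `3, 4` and `5, 6`. -/
def HoldsSolution {n : ℕ} (L : Fin n → Seg) (s : RealRAM.State) : Prop :=
  IsMaxMaxArea L (s.rvar 0) ∧
  ∃ i j k : Fin n, i ≠ j ∧ i ≠ k ∧ j ≠ k ∧
    s.ivar 0 = i ∧ s.ivar 1 = j ∧ s.ivar 2 = k ∧
    (s.rvar 1, s.rvar 2) ∈ (L i).carrier ∧
    (s.rvar 3, s.rvar 4) ∈ (L j).carrier ∧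
    (s.rvar 5, s.rvar 6) ∈ (L k).carrier ∧
    triArea (s.rvar 1, s.rvar 2) (s.rvar 3, s.rvar 4) (s.rvar 5, s.rvar 6) = s.rvar 0

/-! Order the segments by the coordinate x across their common direction `v`, and measure heights
along it. For i < j < k in this order, the signed area is, up to a constant factor, the form (x_j -
x_i)(y_k - z_j) + (y_i - z_j)(x_k - x_j). The coefficients x_j - x_i and x_k - x_j are nonnegative,
so the form is largest when the outer corners are the upper end points (heights y) and the middle
corner is the lower one (height z). The opposite orientation is the same problem with heights
reversed (`w = -v`), and this leaves the order unchanged. It remains to maximize `areaForm` over all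
sorted triples, twice, in quadratic time.

Fix j. For fixed i the form is an affine function of (x_k, y_k) whose y-coefficient is nonnegative,
and likewise with i and k exchanged. Hence only the upper hulls of the points before j and after j
matter, and Graham's scan builds them in linear time (`wp_hullCmd`). Let the left point run
rightwards along its hull. As long as it turns clockwise about (x_j, z_j), the best right vertex
also moves only rightwards (`IsConcaveChain.val_mono`, `IsConcaveChain.val_le`). The left hull need
not be clockwise throughout, but a vertex attaining a positive maximum is preceded by clockwise
edges only (`IsConcaveChain.clockwise_of_max`). So a right pointer that never moves back finds every
positive maximum (`areaForm_le_of_upperHull`, `wp_sweepCmd`). Later left points may get a suboptimal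
partner, but their values still come from true triangles.

The direction `v` is not normalized, so no square root is needed and all areas carry the factor
|v|². The recorded value is at most the scaled doubled area of the recorded triangle, and after both
passes it is at least that of every competitor. Hence the recorded triangle is optimal and its area
can be computed directly. Running times are proved along with correctness, by potentials in the loop
rule `wp_loop`. -/

namespace RealRAM

/-! ### Program logic for timed total correctness -/

/-- The weakest precondition of `c` for a postcondition on the running time and the final state. -/
def wp (c : Cmd) (s : State) (Q : ℕ → State → Prop) : Prop :=
  ∃ t s', Exec c s t s' ∧ Q t s'

theorem wp_mono {c : Cmd} {s : State} {Q R : ℕ → State → Prop} (h : wp c s Q)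
    (hQR : ∀ t s', Q t s' → R t s') : wp c s R := by
  obtain ⟨t, s', h, hq⟩ := h
  exact ⟨t, s', h, hQR _ _ hq⟩

theorem wp_skip {s : State} {Q : ℕ → State → Prop} : wp Cmd.skip s Q ↔ Q 1 s :=
  ⟨by rintro ⟨t, s', h, q⟩; cases h; exact q, fun h => ⟨_, _, Exec.skip s, h⟩⟩

theorem wp_setI {s : State} {x : ℕ} {e : IExpr} {Q : ℕ → State → Prop} :
    wp (Cmd.setI x e) s Q ↔ Q (e.cost + 1) (s.setI x (e.eval s)) :=
  ⟨by rintro ⟨t, s', h, q⟩; cases h; exact q, fun h => ⟨_, _, Exec.setI s x e, h⟩⟩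

theorem wp_setR {s : State} {x : ℕ} {e : RExpr} {Q : ℕ → State → Prop} :
    wp (Cmd.setR x e) s Q ↔ Q (e.cost + 1) (s.setR x (e.eval s)) :=
  ⟨by rintro ⟨t, s', h, q⟩; cases h; exact q, fun h => ⟨_, _, Exec.setR s x e, h⟩⟩

theorem wp_putI {s : State} {a : ℕ} {i e : IExpr} {Q : ℕ → State → Prop} :
    wp (Cmd.putI a i e) s Q ↔ Q (i.cost + e.cost + 1) (s.putI a (i.eval s) (e.eval s)) :=
  ⟨by rintro ⟨t, s', h, q⟩; cases h; exact q, fun h => ⟨_, _, Exec.putI s a i e, h⟩⟩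

theorem wp_putR {s : State} {a : ℕ} {i : IExpr} {e : RExpr} {Q : ℕ → State → Prop} :
    wp (Cmd.putR a i e) s Q ↔ Q (i.cost + e.cost + 1) (s.putR a (i.eval s) (e.eval s)) :=
  ⟨by rintro ⟨t, s', h, q⟩; cases h; exact q, fun h => ⟨_, _, Exec.putR s a i e, h⟩⟩

theorem wp_seq {s : State} {c d : Cmd} {Q : ℕ → State → Prop} :
    wp (Cmd.seq c d) s Q ↔ wp c s fun t s' => wp d s' fun t' s'' => Q (t + t') s'' := by
  constructor
  · rintro ⟨t, s', h, q⟩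
    cases h with
    | seq h₁ h₂ => exact ⟨_, _, h₁, _, _, h₂, q⟩
  · rintro ⟨t, s', h, t', s'', h', q⟩
    exact ⟨_, _, Exec.seq h h', q⟩

theorem wp_cond {s : State} {b : Test} {c d : Cmd} {Q : ℕ → State → Prop} :
    wp (Cmd.cond b c d) s Q ↔
      (b.eval s → wp c s fun t s' => Q (b.cost + 1 + t) s') ∧
      (¬ b.eval s → wp d s fun t s' => Q (b.cost + 1 + t) s') := by
  constructor
  · rintro ⟨t, s', h, q⟩
    cases h with
    | cond_true hb h => exact ⟨fun _ => ⟨_, _, h, q⟩, fun hn => absurd hb hn⟩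
    | cond_false hb h => exact ⟨fun hn => absurd hn hb, fun _ => ⟨_, _, h, q⟩⟩
  · rintro ⟨h₁, h₂⟩
    by_cases hb : b.eval s
    · obtain ⟨t, s', h, q⟩ := h₁ hb
      exact ⟨_, _, Exec.cond_true hb h, q⟩
    · obtain ⟨t, s', h, q⟩ := h₂ hb
      exact ⟨_, _, Exec.cond_false hb h, q⟩

/-! ### Frames -/

/-- The integer variables assigned in a program. -/
def Cmd.ivars : Cmd → List ℕ
  | setI x _ => [x]
  | seq c d => c.ivars ++ d.ivars
  | cond _ c d => c.ivars ++ d.ivars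
  | loop _ c => c.ivars
  | _ => []

/-- The real variables assigned in a program. -/
def Cmd.rvars : Cmd → List ℕ
  | setR x _ => [x]
  | seq c d => c.rvars ++ d.rvars
  | cond _ c d => c.rvars ++ d.rvars
  | loop _ c => c.rvars
  | _ => []

/-- The integer arrays written in a program. -/
def Cmd.iarrs : Cmd → List ℕ
  | putI a _ _ => [a]
  | seq c d => c.iarrs ++ d.iarrs
  | cond _ c d => c.iarrs ++ d.iarrs
  | loop _ c => c.iarrs
  | _ => []

/-- The real arrays written in a program. -/
def Cmd.rarrs : Cmd → List ℕ
  | putR a _ _ => [a]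
  | seq c d => c.rarrs ++ d.rarrs
  | cond _ c d => c.rarrs ++ d.rarrs
  | loop _ c => c.rarrs
  | _ => []

/-- The states `s` and `s'` agree on everything that `c` does not write. -/
structure Frame (c : Cmd) (s s' : State) : Prop where
  ivar : ∀ x, x ∉ c.ivars → s'.ivar x = s.ivar x
  rvar : ∀ x, x ∉ c.rvars → s'.rvar x = s.rvar x
  iarr : ∀ x, x ∉ c.iarrs → s'.iarr x = s.iarr x
  rarr : ∀ x, x ∉ c.rarrs → s'.rarr x = s.rarr x

theorem Frame.refl (c : Cmd) (s : State) : Frame c s s :=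
  ⟨fun _ _ => rfl, fun _ _ => rfl, fun _ _ => rfl, fun _ _ => rfl⟩

theorem Frame.trans {c : Cmd} {s s' s'' : State} (h : Frame c s s') (h' : Frame c s' s'') :
    Frame c s s'' :=
  ⟨fun x hx => (h'.ivar x hx).trans (h.ivar x hx), fun x hx => (h'.rvar x hx).trans (h.rvar x hx),
    fun x hx => (h'.iarr x hx).trans (h.iarr x hx), fun x hx => (h'.rarr x hx).trans (h.rarr x hx)⟩

theorem Frame.of_subset {c d : Cmd} {s s' : State} (h : Frame c s s')
    (h₁ : c.ivars ⊆ d.ivars) (h₂ : c.rvars ⊆ d.rvars) (h₃ : c.iarrs ⊆ d.iarrs)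
    (h₄ : c.rarrs ⊆ d.rarrs) : Frame d s s' :=
  ⟨fun x hx => h.ivar x fun h => hx (h₁ h), fun x hx => h.rvar x fun h => hx (h₂ h),
    fun x hx => h.iarr x fun h => hx (h₃ h), fun x hx => h.rarr x fun h => hx (h₄ h)⟩

/-- The write sets are syntactic, so for a concrete program the side conditions fall to `decide` or
`simp`, and loop invariants need not mention memory that the loop leaves alone. -/
theorem Exec.frame {c : Cmd} {s s' : State} {t : ℕ} (h : Exec c s t s') : Frame c s s' := by
  induction h with
  | skip s => exact Frame.refl _ _
  | setI s x e =>
    refine ⟨fun y hy => ?_, fun _ _ => rfl, fun _ _ => rfl, fun _ _ => rfl⟩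
    simp only [Cmd.ivars, List.mem_singleton] at hy
    simp [State.setI, hy]
  | setR s x e =>
    refine ⟨fun _ _ => rfl, fun y hy => ?_, fun _ _ => rfl, fun _ _ => rfl⟩
    simp only [Cmd.rvars, List.mem_singleton] at hy
    simp [State.setR, hy]
  | putI s a i e =>
    refine ⟨fun _ _ => rfl, fun _ _ => rfl, fun y hy => ?_, fun _ _ => rfl⟩
    simp only [Cmd.iarrs, List.mem_singleton] at hy
    simp [State.putI, hy]
  | putR s a i e =>
    refine ⟨fun _ _ => rfl, fun _ _ => rfl, fun _ _ => rfl, fun y hy => ?_⟩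
    simp only [Cmd.rarrs, List.mem_singleton] at hy
    simp [State.putR, hy]
  | seq _ _ ih ih' =>
    refine (ih.of_subset ?_ ?_ ?_ ?_).trans (ih'.of_subset ?_ ?_ ?_ ?_) <;>
      simp [Cmd.ivars, Cmd.rvars, Cmd.iarrs, Cmd.rarrs]
  | cond_true _ _ ih | cond_false _ _ ih =>
    refine ih.of_subset ?_ ?_ ?_ ?_ <;> simp [Cmd.ivars, Cmd.rvars, Cmd.iarrs, Cmd.rarrs]
  | loop_true _ _ _ ih ih' =>
    refine Frame.trans (ih.of_subset ?_ ?_ ?_ ?_) ih' <;>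
      simp [Cmd.ivars, Cmd.rvars, Cmd.iarrs, Cmd.rarrs]
  | loop_false _ => exact Frame.refl _ _

theorem wp_frame {c : Cmd} {s : State} {Q : ℕ → State → Prop}
    (h : wp c s fun t s' => Frame c s s' → Q t s') : wp c s Q := by
  obtain ⟨t, s', h, q⟩ := h
  exact ⟨t, s', h, q h.frame⟩

/-- The loop rule, with an invariant `I` and a potential `Φ` paying for the running time. -/
theorem wp_loop {b : Test} {c : Cmd} {s : State} {Q : ℕ → State → Prop}
    (I : State → Prop) (Φ : State → ℕ) (hI : I s)
    (body : ∀ s₁, Frame c s s₁ → I s₁ → b.eval s₁ →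
      wp c s₁ fun t s₂ => I s₂ ∧ t + b.cost + 1 + Φ s₂ ≤ Φ s₁)
    (post : ∀ t s₁, Frame c s s₁ → I s₁ → ¬ b.eval s₁ → t + Φ s₁ ≤ Φ s + b.cost + 1 → Q t s₁) :
    wp (Cmd.loop b c) s Q := by
  -- Every round costs at least one step and hence lowers the potential; induction on a bound for it
  -- yields termination together with the time bound.
  have key : ∀ N s₁, Φ s₁ ≤ N → Frame c s s₁ → I s₁ →
      ∃ t s₂, Exec (Cmd.loop b c) s₁ t s₂ ∧ Frame c s s₂ ∧ I s₂ ∧ ¬ b.eval s₂ ∧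
        t + Φ s₂ ≤ Φ s₁ + b.cost + 1 := by
    intro N
    induction N with
    | zero =>
      intro s₁ hN hf hi
      by_cases hb : b.eval s₁
      · obtain ⟨t, s₂, -, -, h⟩ := body s₁ hf hi hb
        omega
      · exact ⟨_, s₁, Exec.loop_false hb, hf, hi, hb, by omega⟩
    | succ N ih =>
      intro s₁ hN hf hi
      by_cases hb : b.eval s₁
      · obtain ⟨t, s₂, he, hi₂, h⟩ := body s₁ hf hi hb
        obtain ⟨t', s₃, he', hf', hi', hb', h'⟩ := ih s₂ (by omega) (hf.trans he.frame) hi₂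
        exact ⟨_, s₃, Exec.loop_true hb he he', hf', hi', hb', by omega⟩
      · exact ⟨_, s₁, Exec.loop_false hb, hf, hi, hb, by omega⟩
  obtain ⟨t, s₂, he, hf, hi, hb, h⟩ := key _ s le_rfl (Frame.refl _ _) hI
  exact ⟨t, s₂, he, post t s₂ hf hi hb h⟩

/-- The rule for a loop with a decreasing counter `m` and bodies of time less than `K`. -/
theorem wp_loop_counted {b : Test} {c : Cmd} {s : State} {Q : ℕ → State → Prop}
    (I : State → Prop) (m : State → ℕ) (K : ℕ) (hI : I s)
    (body : ∀ s₁, Frame c s s₁ → I s₁ → b.eval s₁ →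
      wp c s₁ fun t s₂ => I s₂ ∧ m s₂ + 1 = m s₁ ∧ t + b.cost + 1 ≤ K)
    (post : ∀ t s₁, Frame c s s₁ → I s₁ → ¬ b.eval s₁ → t ≤ K * m s + b.cost + 1 → Q t s₁) :
    wp (Cmd.loop b c) s Q := by
  refine wp_loop I (fun s => K * m s) hI (fun s₁ hf hi hb => ?_)
    fun t s₁ hf hi hb ht => post t s₁ hf hi hb (by omega)
  refine wp_mono (body s₁ hf hi hb) fun t s₂ h => ⟨h.1, ?_⟩
  rw [← h.2.1, Nat.mul_add]
  omega

/-! ### Reading updated states -/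

section
variable (s : State) (x y v i : ℕ) (u : ℝ)

theorem ivar_setI : (s.setI x v).ivar y = if y = x then v else s.ivar y := by
  simp [State.setI, Function.update_apply]
theorem rvar_setI : (s.setI x v).rvar = s.rvar := rfl
theorem iarr_setI : (s.setI x v).iarr = s.iarr := rfl
theorem rarr_setI : (s.setI x v).rarr = s.rarr := rfl
theorem ivar_setR : (s.setR x u).ivar = s.ivar := rfl
theorem rvar_setR : (s.setR x u).rvar y = if y = x then u else s.rvar y := by
  simp [State.setR, Function.update_apply]
theorem iarr_setR : (s.setR x u).iarr = s.iarr := rfl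
theorem rarr_setR : (s.setR x u).rarr = s.rarr := rfl
theorem ivar_putI : (s.putI x i v).ivar = s.ivar := rfl
theorem rvar_putI : (s.putI x i v).rvar = s.rvar := rfl
theorem iarr_putI : (s.putI x i v).iarr y =
    if y = x then Function.update (s.iarr x) i v else s.iarr y := by
  simp [State.putI, Function.update_apply]
theorem rarr_putI : (s.putI x i v).rarr = s.rarr := rfl
theorem ivar_putR : (s.putR x i u).ivar = s.ivar := rfl
theorem rvar_putR : (s.putR x i u).rvar = s.rvar := rfl
theorem iarr_putR : (s.putR x i u).iarr = s.iarr := rfl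
theorem rarr_putR : (s.putR x i u).rarr y =
    if y = x then Function.update (s.rarr x) i u else s.rarr y := by
  simp [State.putR, Function.update_apply]
end

attribute [simp] wp_skip wp_setI wp_setR wp_putI wp_putR wp_seq wp_cond
  ivar_setI rvar_setI iarr_setI rarr_setI ivar_setR rvar_setR iarr_setR rarr_setR
  ivar_putI rvar_putI iarr_putI rarr_putI ivar_putR rvar_putR iarr_putR rarr_putR
  IExpr.eval RExpr.eval Test.eval IExpr.cost RExpr.cost Test.cost
  Cmd.ivars Cmd.rvars Cmd.iarrs Cmd.rarrs

end RealRAM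

/-! ### Concave chains -/

/-- The triangle area form of the points `(x i, y i)`, `(x j, z j)`, `(x k, y k)`. -/
def areaForm (x y z : ℕ → ℝ) (i j k : ℕ) : ℝ :=
  (x j - x i) * (y k - z j) + (y i - z j) * (x k - x j)

/-- The points `p, q, r` make a right turn. -/
def RightTurn (x y : ℕ → ℝ) (p q r : ℕ) : Prop :=
  (x q - x p) * (y r - y p) < (x r - x p) * (y q - y p)

/-- The first `m` points of the sequence `S` form a strictly concave, `x`-monotone chain. -/
structure IsConcaveChain (x y : ℕ → ℝ) (S : ℕ → ℕ) (m : ℕ) : Prop where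
  lt : ∀ a, a + 1 < m → x (S a) < x (S (a + 1))
  turn : ∀ a, a + 2 < m → RightTurn x y (S a) (S (a + 1)) (S (a + 2))

/-- In every direction of the closed upper half-plane, some point of `P` is at least as far as
the point `p`. -/
def IsDominated (x y : ℕ → ℝ) (P : ℕ → Prop) (p : ℕ) : Prop :=
  ∀ α β : ℝ, 0 ≤ α → ∃ q, P q ∧ α * y p + β * x p ≤ α * y q + β * x q

/-- The first `m` points of `S` form the upper hull of the points with numbers in `[lo, hi)`. -/
structure IsUpperHull (x y : ℕ → ℝ) (lo hi : ℕ) (S : ℕ → ℕ) (m : ℕ) : Prop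
    extends IsConcaveChain x y S m where
  mem : ∀ a < m, lo ≤ S a ∧ S a < hi
  dom : ∀ p, lo ≤ p → p < hi → IsDominated x y (fun q => ∃ a < m, q = S a) p

variable {x y z : ℕ → ℝ} {S : ℕ → ℕ} {m : ℕ}

theorem IsDominated.of_mem {P : ℕ → Prop} {p : ℕ} (h : P p) : IsDominated x y P p :=
  fun _ _ _ => ⟨p, h, le_rfl⟩

theorem IsDominated.trans {P Q : ℕ → Prop} {p : ℕ} (h : IsDominated x y P p)
    (hPQ : ∀ q, P q → IsDominated x y Q q) : IsDominated x y Q p := by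
  intro α β hα
  obtain ⟨q, hq, hle⟩ := h α β hα
  obtain ⟨r, hr, hle'⟩ := hPQ q hq α β hα
  exact ⟨r, hr, hle.trans hle'⟩

theorem IsDominated.of_le {P : ℕ → Prop} {p q : ℕ} (hq : P q) (hx : x p = x q) (hy : y p ≤ y q) :
    IsDominated x y P p := fun α β hα => ⟨q, hq, by
  rw [hx]
  gcongr⟩

/-- A point on or below the chord from `p` to `r` lies on or below a convex combination of `p` and
`r` with the same abscissa, so for α ≥ 0 one of the two ends does at least as well. -/
theorem IsDominated.of_not_rightTurn {P : ℕ → Prop} {p q r : ℕ} (hp : P p) (hr : P r)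
    (hpq : x p < x q) (hqr : x q ≤ x r) (h : ¬ RightTurn x y p q r) : IsDominated x y P q := by
  intro α β hα
  rw [RightTurn, not_lt] at h
  by_contra! hc
  have h1 := hc p hp
  have h2 := hc r hr
  have h3 := mul_le_mul_of_nonneg_left h hα
  have h4 := mul_lt_mul_of_pos_left h2 (sub_pos.2 hpq)
  have h5 := mul_le_mul_of_nonneg_left h1.le (sub_nonneg.2 hqr)
  linarith

theorem IsConcaveChain.mono {m' : ℕ} (h : IsConcaveChain x y S m) (hm : m' ≤ m) :
    IsConcaveChain x y S m' :=
  ⟨fun a ha => h.lt a (by omega), fun a ha => h.turn a (by omega)⟩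

theorem IsConcaveChain.push (h : IsConcaveChain x y S m) {r : ℕ}
    (hx : 0 < m → x (S (m - 1)) < x r)
    (ht : 1 < m → RightTurn x y (S (m - 2)) (S (m - 1)) r) :
    IsConcaveChain x y (Function.update S m r) (m + 1) := by
  constructor
  · intro a ha
    rw [Function.update_of_ne (by omega)]
    by_cases ham : a + 1 = m
    · subst ham
      simpa using hx
    · rw [Function.update_of_ne ham]
      exact h.lt a (by omega)
  · intro a ha
    rw [Function.update_of_ne (by omega), Function.update_of_ne (by omega)]
    by_cases ham : a + 2 = m
    · subst ham
      simpa using ht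
    · rw [Function.update_of_ne ham]
      exact h.turn a (by omega)

/-- A linear functional that starts to decrease along a concave chain keeps decreasing. -/
theorem IsConcaveChain.val_le (h : IsConcaveChain x y S m) {α β : ℝ} (hα : 0 ≤ α) {k : ℕ}
    (hk : k + 1 < m →
      α * y (S (k + 1)) + β * x (S (k + 1)) ≤ α * y (S k) + β * x (S k))
    {q : ℕ} (hkq : k ≤ q) (hq : q < m) :
    α * y (S q) + β * x (S q) ≤ α * y (S k) + β * x (S k) := by
  have step : ∀ q, k ≤ q → q + 1 < m →
      α * y (S (q + 1)) + β * x (S (q + 1)) ≤ α * y (S q) + β * x (S q) := by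
    intro q hkq
    induction q, hkq using Nat.le_induction with
    | base => exact hk
    | succ q hkq ih =>
      intro hq
      have h0 := ih (by omega)
      have h1 := h.lt q (by omega)
      have h2 := h.lt (q + 1) (by omega)
      have h3 := h.turn q (by omega)
      rw [RightTurn] at h3
      -- Slopes fall along the chain, so with α ≥ 0 a decrease on one edge forces a decrease on the
      -- next; denominators are cleared by the width of the earlier edge.
      have h4 := mul_le_mul_of_nonneg_left h3.le hα
      have h5 := mul_le_mul_of_nonneg_left h0 (sub_nonneg.2 h2.le)
      refine le_of_mul_le_mul_left ?_ (sub_pos.2 h1)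
      linarith
  induction q, hkq using Nat.le_induction with
  | base => exact le_rfl
  | succ q hkq ih => exact (step q hkq hq).trans (ih (by omega))

/-- Seen from below, the points `b` and `b + 1` of a chain come in clockwise order. -/
def Clockwise (x y : ℕ → ℝ) (S : ℕ → ℕ) (x₀ z₀ : ℝ) (b : ℕ) : Prop :=
  (x₀ - x (S (b + 1))) * (y (S b) - z₀) ≤ (x₀ - x (S b)) * (y (S (b + 1)) - z₀)

/-- A pair of points in increasing order stays so for the later points in clockwise order. -/
theorem IsConcaveChain.val_mono (h : IsConcaveChain x y S m) {x₀ z₀ : ℝ}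
    (hx : ∀ a < m, x (S a) ≤ x₀) {b a : ℕ} (hba : b ≤ a) (ha : a < m)
    (hcw : ∀ c < a, Clockwise x y S x₀ z₀ c) {p q : ℕ} (hpq : x p ≤ x q)
    (hb : (x₀ - x (S b)) * y p + (y (S b) - z₀) * x p
      ≤ (x₀ - x (S b)) * y q + (y (S b) - z₀) * x q) :
    (x₀ - x (S a)) * y p + (y (S a) - z₀) * x p
      ≤ (x₀ - x (S a)) * y q + (y (S a) - z₀) * x q := by
  induction a, hba using Nat.le_induction with
  | base => exact hb
  | succ a hba ih =>
    have h0 := ih (by omega) fun c hc => hcw c (by omega)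
    have h1 := h.lt a ha
    have h2 := hx (a + 1) ha
    have h3 := hcw a (by omega)
    rw [Clockwise] at h3
    -- Since `p` is not to the right of `q`, the comparison can only improve when the ratio of the
    -- x-coefficient to the y-coefficient grows, which is what `Clockwise` provides. The multiplier
    -- is positive because a later hull point still lies at or before `x₀`.
    have h4 := mul_le_mul_of_nonneg_left h0 (sub_nonneg.2 h2)
    have h5 := mul_le_mul_of_nonneg_left h3 (sub_nonneg.2 hpq)
    refine le_of_mul_le_mul_left ?_ (show 0 < x₀ - x (S a) by linarith)
    linarith

/-- Up to a point where a linear functional through `(x₀, z₀)` has a positive maximum, the chain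
is in clockwise order. -/
theorem IsConcaveChain.clockwise_of_max (h : IsConcaveChain x y S m) {x₀ z₀ u v : ℝ}
    (hx : ∀ a < m, x (S a) ≤ x₀) (hu : 0 ≤ u) {a : ℕ} (ha : a < m)
    (hpos : 0 < (x₀ - x (S a)) * v + (y (S a) - z₀) * u)
    (hmax : ∀ b < m, (x₀ - x (S b)) * v + (y (S b) - z₀) * u
      ≤ (x₀ - x (S a)) * v + (y (S a) - z₀) * u) :
    ∀ c < a, Clockwise x y S x₀ z₀ c := by
  -- On an x-monotone chain, `Clockwise` at c means that (x₀, z₀) lies on or below the line through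
  -- the points c and c + 1. The induction goes backwards from the maximizing vertex.
  have key : ∀ d c, c + 1 + d = a → Clockwise x y S x₀ z₀ c := by
    intro d
    induction d with
    | zero =>
      rintro c rfl
      simp only [add_zero] at *
      rw [Clockwise]
      -- With F the functional and a = c + 1, failure would give (x₀ - x_a) F(c) ≥ (x₀ - x_c) F(a) >
      -- (x₀ - x_a) F(a), by positivity of F(a), against the maximality of F(a).
      by_contra! hc
      have h1 := h.lt c ha
      have h2 := hx (c + 1) ha
      have h3 := hmax c (by omega)
      have h4 := mul_le_mul_of_nonneg_left hc.le hu
      have h5 := mul_le_mul_of_nonneg_left h3 (sub_nonneg.2 h2)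
      have h6 := mul_pos (sub_pos.2 h1) hpos
      linarith
    | succ d ih =>
      intro c hc
      have h0 := ih (c + 1) (by omega)
      have h1 := h.lt c (by omega)
      have h2 := h.lt (c + 1) (by omega)
      have h3 := hx (c + 2) (by omega)
      have h4 := h.turn c (by omega)
      rw [Clockwise] at h0 ⊢
      rw [RightTurn] at h4
      rw [show c + 1 + 1 = c + 2 by rfl] at *
      -- The earlier edge is steeper and shares the point c + 1 with the later one, so its line
      -- passes at least as high over `x₀`.
      have h5 := mul_le_mul_of_nonneg_left h0
        (show 0 ≤ x (S (c + 1)) - x (S c) by linarith)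
      have h6 := mul_le_mul_of_nonneg_left h4.le
        (show 0 ≤ x₀ - x (S (c + 1)) by linarith)
      refine le_of_mul_le_mul_left ?_ (show 0 < x (S (c + 2)) - x (S (c + 1)) by linarith)
      linarith
  intro c hc
  exact key (a - (c + 1)) c (by omega)

/-- If the triangles on the clockwise part of the left hull have area form at most `A`, then all
have. -/
theorem areaForm_le_of_upperHull {S' : ℕ → ℕ} {m' j n : ℕ} {A : ℝ} (hA : 0 ≤ A)
    (hx : ∀ p q, p ≤ q → q < n → x p ≤ x q) (hj : j < n)
    (h : IsUpperHull x y 0 j S m) (h' : IsUpperHull x y (j + 1) n S' m')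
    (hle : ∀ a < m, (∀ c < a, Clockwise x y S (x j) (z j) c) → ∀ q < m',
      areaForm x y z (S a) j (S' q) ≤ A)
    {i k : ℕ} (hij : i < j) (hjk : j < k) (hk : k < n) : areaForm x y z i j k ≤ A := by
  by_contra! hlt
  -- The outer corners are moved to the hulls one at a time, each by domination in the direction
  -- given by the coefficients of the form.
  obtain ⟨_, ⟨q, hq, rfl⟩, hkq⟩ := h'.dom k hjk hk (x j - x i) (y i - z j)
    (sub_nonneg.2 (hx i j hij.le hj))
  have h1 : A < areaForm x y z i j (S' q) := by
    unfold areaForm at *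
    linarith
  have hu : x j ≤ x (S' q) := hx _ _ (by have := h'.mem q hq; omega) (h'.mem q hq).2
  obtain ⟨_, ⟨a₀, ha₀, rfl⟩, hi⟩ := h.dom i (Nat.zero_le _) hij (x (S' q) - x j)
    (z j - y (S' q)) (sub_nonneg.2 hu)
  have h2 : A < areaForm x y z (S a₀) j (S' q) := by
    unfold areaForm at *
    linarith
  -- Only a left vertex that is optimal for the partner `S' q` is known to have a clockwise prefix;
  -- its value exceeds `A ≥ 0` and is therefore positive.
  obtain ⟨a, ha, hmax⟩ := Finset.exists_max_image (Finset.range m)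
    (fun a => areaForm x y z (S a) j (S' q)) ⟨a₀, Finset.mem_range.2 ha₀⟩
  have h3 := hmax a₀ (Finset.mem_range.2 ha₀)
  rw [Finset.mem_range] at ha
  have h4 := hle a ha (h.clockwise_of_max (u := x (S' q) - x j) (v := y (S' q) - z j)
    (fun b hb => hx _ _ (h.mem b hb).2.le hj) (sub_nonneg.2 hu) ha
    (by unfold areaForm at *; linarith) fun b hb => hmax b (Finset.mem_range.2 hb)) q hq
  linarith

/-! ### Graham's scan -/

namespace RealRAM

/-- The `i`-th real of array `a` in sorted order. -/
def RExpr.sorted (a : ℕ) (i : IExpr) : RExpr := .get a (.get 0 i)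

attribute [simp] RExpr.sorted

/-- The test for a right turn of the three points with the numbers `p, q, r`. -/
def Test.turn (p q r : IExpr) : Test :=
  .rlt (.mul (.sub (.sorted 4 q) (.sorted 4 p)) (.sub (.sorted 5 r) (.sorted 5 p)))
    (.mul (.sub (.sorted 4 r) (.sorted 4 p)) (.sub (.sorted 5 q) (.sorted 5 p)))

attribute [simp] Test.turn

/-- The entry of the integer array `A` that is `d` places below the top of its stack of size `M`. -/
def IExpr.fromTop (A M d : ℕ) : IExpr := .get A (.sub (.var M) (.const d))

attribute [simp] IExpr.fromTop

/-- Is the top of the stack to be removed before the point with number `ivar 8` is added? -/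
def popTest (A M : ℕ) : Test :=
  .conj (.ilt (.const 0) (.var M))
    (.neg (.conj (.rlt (.sorted 4 (.fromTop A M 1)) (.sorted 4 (.var 8)))
      (.neg (.conj (.ilt (.const 1) (.var M))
        (.neg (.turn (.fromTop A M 2) (.fromTop A M 1) (.var 8)))))))

/-- Is the point with number `ivar 8` below the top of the stack? -/
def skipTest (A M : ℕ) : Test :=
  .conj (.ilt (.const 0) (.var M))
    (.conj (.neg (.rlt (.sorted 4 (.fromTop A M 1)) (.sorted 4 (.var 8))))
      (.neg (.rlt (.sorted 5 (.fromTop A M 1)) (.sorted 5 (.var 8)))))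

def popCmd (A M : ℕ) : Cmd := .loop (popTest A M) (.setI M (.sub (.var M) (.const 1)))

def insertCmd (A M : ℕ) : Cmd :=
  .cond (skipTest A M) .skip
    (.seq (popCmd A M) (.seq (.putI A (.var M) (.var 8)) (.setI M (.add (.var M) (.const 1)))))

/-- Graham's scan: build in the array `A` the upper hull of the points with numbers from `ivar 8`
to `ivar 9`, and put its size into `ivar M`. -/
def hullCmd (A M : ℕ) : Cmd :=
  .seq (.setI M (.const 0))
    (.loop (.ilt (.var 8) (.var 9))
      (.seq (insertCmd A M) (.setI 8 (.add (.var 8) (.const 1)))))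

/-- Each removal is paid for by the 100 units of potential of the removed entry. Such an entry is
either on the vertical of `r` and not above it, by `htop`, or not above the chord from the entry
below it to `r`; in both cases the remaining entries together with `r` dominate it. -/
theorem wp_popCmd {A M : ℕ} (hM : M ≠ 8) {s : State} {π : ℕ → ℕ} {X T x y : ℕ → ℝ}
    (hπ : s.iarr 0 = π) (hX : s.rarr 4 = X) (hT : s.rarr 5 = T) (hx : x = X ∘ π) (hy : y = T ∘ π)
    {lo r : ℕ} (hr : s.ivar 8 = r)
    (hhull : IsUpperHull x y lo r (s.iarr A) (s.ivar M))
    (hle : ∀ a < s.ivar M, x (s.iarr A a) ≤ x r)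
    (htop : 0 < s.ivar M → x (s.iarr A (s.ivar M - 1)) = x r → y (s.iarr A (s.ivar M - 1)) ≤ y r) :
    wp (popCmd A M) s fun t s' =>
      t + 100 * s'.ivar M ≤ 100 * s.ivar M + 80 ∧ s'.ivar M ≤ s.ivar M ∧
      (0 < s'.ivar M → x (s.iarr A (s'.ivar M - 1)) < x r) ∧
      (1 < s'.ivar M → RightTurn x y (s.iarr A (s'.ivar M - 2)) (s.iarr A (s'.ivar M - 1)) r) ∧
      ∀ p, lo ≤ p → p < r →
        IsDominated x y (fun q => (∃ a < s'.ivar M, q = s.iarr A a) ∨ q = r) p := by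
  have hlt {a b : ℕ} (hab : a < b) (hb : b < s.ivar M) : x (s.iarr A a) < x (s.iarr A b) := by
    induction b, hab using Nat.le_induction with
    | base => exact hhull.lt a hb
    | succ b _ ih => exact (ih (by omega)).trans (hhull.lt b hb)
  refine wp_loop (fun s' => s'.ivar M ≤ s.ivar M ∧
    (0 < s'.ivar M → x (s.iarr A (s'.ivar M - 1)) = x r →
      y (s.iarr A (s'.ivar M - 1)) ≤ y r) ∧
    ∀ p, lo ≤ p → p < r →
      IsDominated x y (fun q => (∃ a < s'.ivar M, q = s.iarr A a) ∨ q = r) p)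
    (fun s' => 100 * s'.ivar M) ⟨le_rfl, htop, fun p h₁ h₂ => (hhull.dom p h₁ h₂).trans
      fun q hq => .of_mem (.inl hq)⟩ ?_ ?_
  · rintro s₁ hf ⟨hm, ht, hd⟩ hb
    have e0 : s₁.iarr 0 = π := (hf.iarr 0 (by simp)).trans hπ
    have eA : s₁.iarr A = s.iarr A := hf.iarr A (by simp)
    have e4 : s₁.rarr 4 = X := (hf.rarr 4 (by simp)).trans hX
    have e5 : s₁.rarr 5 = T := (hf.rarr 5 (by simp)).trans hT
    have e8 : s₁.ivar 8 = r := (hf.ivar 8 (by simp [hM.symm])).trans hr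
    simp only [popTest, Test.turn, Test.eval, IExpr.eval, RExpr.eval, RExpr.sorted, IExpr.fromTop,
      e0, eA, e4, e5, e8] at hb
    obtain ⟨hpos, hb⟩ := hb
    set k := s₁.ivar M with hk
    have hdom : IsDominated x y
        (fun q => (∃ a < k - 1, q = s.iarr A a) ∨ q = r) (s.iarr A (k - 1)) := by
      by_cases hxr : x (s.iarr A (k - 1)) < x r
      · have h1 : 1 < k ∧ ¬ RightTurn x y (s.iarr A (k - 2)) (s.iarr A (k - 1)) r := by
          subst hx hy
          by_contra hc
          exact hb ⟨hxr, hc⟩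
        exact .of_not_rightTurn (.inl ⟨k - 2, by omega, rfl⟩) (.inr rfl)
          (hlt (by omega) (by omega)) hxr.le h1.2
      · have := le_antisymm (hle (k - 1) (by omega)) (not_lt.1 hxr)
        exact .of_le (.inr rfl) this (ht hpos this)
    simp only [wp_setI, ivar_setI, if_true, IExpr.eval, ← hk]
    refine ⟨⟨by omega, fun h0 he => ?_, fun p h₁ h₂ => (hd p h₁ h₂).trans ?_⟩, ?_⟩
    -- The entry below the removed one lies strictly to the left of `r`, so equal abscissas can
    -- occur only at the original top.
    · have := hlt (a := k - 1 - 1) (b := k - 1) (by omega) (by omega)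
      have := hle (k - 1) (by omega)
      linarith
    · rintro q (⟨a, ha, rfl⟩ | rfl)
      · by_cases hak : a = k - 1
        · rw [hak]
          exact hdom
        · exact .of_mem (.inl ⟨a, by omega, rfl⟩)
      · exact .of_mem (.inr rfl)
    · simp [popTest]
      omega
  · rintro t s₁ hf ⟨hm, ht, hd⟩ hb htime
    have e0 : s₁.iarr 0 = π := (hf.iarr 0 (by simp)).trans hπ
    have eA : s₁.iarr A = s.iarr A := hf.iarr A (by simp)
    have e4 : s₁.rarr 4 = X := (hf.rarr 4 (by simp)).trans hX
    have e5 : s₁.rarr 5 = T := (hf.rarr 5 (by simp)).trans hT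
    have e8 : s₁.ivar 8 = r := (hf.ivar 8 (by simp [hM.symm])).trans hr
    simp only [popTest, Test.turn, Test.eval, IExpr.eval, RExpr.eval, RExpr.sorted, IExpr.fromTop,
      e0, eA, e4, e5, e8] at hb
    simp [popTest] at htime
    refine ⟨by omega, hm, fun h0 => ?_, fun h1 => ?_, hd⟩
    · subst hx hy
      by_contra hc
      exact hb ⟨h0, fun h => hc h.1⟩
    · subst hx hy
      by_contra hc
      exact hb ⟨by omega, fun h => h.2 ⟨h1, hc⟩⟩

/-- The skip test catches a new point that is on the vertical of the top and not above it. Otherwise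
a top with the same abscissa is lower than the new point, which is the hypothesis `htop` of
`wp_popCmd`. -/
theorem wp_insertCmd {A M : ℕ} (hM : M ≠ 8) {s : State} {π : ℕ → ℕ} {X T x y : ℕ → ℝ}
    (hπ : s.iarr 0 = π) (hX : s.rarr 4 = X) (hT : s.rarr 5 = T) (hx : x = X ∘ π) (hy : y = T ∘ π)
    {lo r : ℕ} (hr : s.ivar 8 = r) (hlo : lo ≤ r)
    (hhull : IsUpperHull x y lo r (s.iarr A) (s.ivar M))
    (hle : ∀ a < s.ivar M, x (s.iarr A a) ≤ x r) :
    wp (insertCmd A M) s fun t s' =>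
      t + 100 * s'.ivar M ≤ 100 * s.ivar M + 300 ∧
      IsUpperHull x y lo (r + 1) (s'.iarr A) (s'.ivar M) := by
  rw [insertCmd, wp_cond]
  constructor
  · intro hb
    simp only [skipTest, Test.eval, IExpr.eval, RExpr.eval, RExpr.sorted, IExpr.fromTop,
      hπ, hX, hT, hr] at hb
    obtain ⟨hpos, h1, h2⟩ := hb
    rw [wp_skip]
    refine ⟨by simp [skipTest]; omega, hhull.toIsConcaveChain, fun a ha => ?_, fun p h₁ h₂ => ?_⟩
    · have := hhull.mem a ha
      omega
    · rcases Nat.lt_succ_iff_lt_or_eq.1 h₂ with h₂ | rfl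
      · exact hhull.dom p h₁ h₂
      · refine .of_le ⟨s.ivar M - 1, by omega, rfl⟩
          (le_antisymm (by subst hx; exact not_lt.1 h1) (hle _ (by omega)))
          (by subst hy; exact not_lt.1 h2)
  · intro hb
    simp only [skipTest, Test.eval, IExpr.eval, RExpr.eval, RExpr.sorted, IExpr.fromTop,
      hπ, hX, hT, hr] at hb
    rw [wp_seq]
    refine wp_frame (wp_mono (wp_popCmd hM hπ hX hT hx hy hr hhull hle fun h0 he => ?_) ?_)
    · subst hx hy
      by_contra hc
      exact hb ⟨h0, he.ge.not_gt, fun h => hc h.le⟩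
    · rintro t s₁ ⟨ht, hm, hlt, hturn, hdom⟩ hf
      have eA : s₁.iarr A = s.iarr A := hf.iarr A (by simp [popCmd])
      have e8 : s₁.ivar 8 = r := (hf.ivar 8 (by simp [popCmd, hM.symm])).trans hr
      simp only [wp_seq, wp_putI, wp_setI, ivar_setI, ivar_putI, iarr_setI, iarr_putI, if_true,
        IExpr.eval, eA, e8]
      refine ⟨?_, (hhull.mono hm).push hlt hturn, fun a ha => ?_, fun p h₁ h₂ => ?_⟩
      · simp [skipTest]
        omega
      · by_cases ham : a = s₁.ivar M
        · subst ham
          simp [hlo]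
        · rw [Function.update_of_ne ham]
          have := hhull.mem a (by omega)
          omega
      · have hmem : ∀ q, (∃ a < s₁.ivar M, q = s.iarr A a) ∨ q = r →
            ∃ a < s₁.ivar M + 1, q = Function.update (s.iarr A) (s₁.ivar M) r a := by
          rintro q (⟨a, ha, rfl⟩ | rfl)
          · exact ⟨a, by omega, by rw [Function.update_of_ne (by omega)]⟩
          · exact ⟨s₁.ivar M, by omega, by simp⟩
        rcases Nat.lt_succ_iff_lt_or_eq.1 h₂ with h₂ | rfl
        · exact (hdom p h₁ h₂).trans fun q hq => .of_mem (hmem q hq)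
        · exact .of_mem (hmem p (.inr rfl))

/-- Every point enters the stack at most once, so potentials of 100 per stack entry and 400 per
point still to come give linear time. -/
theorem wp_hullCmd {A M : ℕ} (hM : M ≠ 8) (hM' : M ≠ 9) (hA : A ≠ 0) {s : State} {π : ℕ → ℕ}
    {X T x y : ℕ → ℝ} (hπ : s.iarr 0 = π) (hX : s.rarr 4 = X) (hT : s.rarr 5 = T)
    (hx : x = X ∘ π) (hy : y = T ∘ π) {lo hi : ℕ} (hlo : s.ivar 8 = lo) (hhi : s.ivar 9 = hi)
    (hle : lo ≤ hi) (hmono : ∀ p q, p ≤ q → q < hi → x p ≤ x q) :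
    wp (hullCmd A M) s fun t s' =>
      t ≤ 500 * (hi - lo) + 10 ∧ IsUpperHull x y lo hi (s'.iarr A) (s'.ivar M) := by
  rw [hullCmd, wp_seq, wp_setI]
  refine wp_loop (fun s' => lo ≤ s'.ivar 8 ∧ s'.ivar 8 ≤ hi ∧
    IsUpperHull x y lo (s'.ivar 8) (s'.iarr A) (s'.ivar M))
    (fun s' => 100 * s'.ivar M + 400 * (hi - s'.ivar 8)) ?_ ?_ ?_
  · simp only [ivar_setI, hM.symm, if_false, hlo, if_true, IExpr.eval]
    exact ⟨le_rfl, hle, ⟨fun _ h => by omega, fun _ h => by omega⟩, fun _ h => by omega,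
      fun p h₁ h₂ => by omega⟩
  · rintro s₁ hf ⟨h₁, h₂, hhull⟩ hb
    have e0 : s₁.iarr 0 = π := (hf.iarr 0 (by simp [insertCmd, popCmd, hA.symm])).trans hπ
    have e4 : s₁.rarr 4 = X := (hf.rarr 4 (by simp [insertCmd, popCmd])).trans hX
    have e5 : s₁.rarr 5 = T := (hf.rarr 5 (by simp [insertCmd, popCmd])).trans hT
    have e9 : s₁.ivar 9 = hi := by
      rw [hf.ivar 9 (by simp [insertCmd, popCmd, hM'.symm])]
      simp [hM'.symm, hhi]
    simp only [Test.eval, IExpr.eval, e9] at hb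
    rw [wp_seq]
    refine wp_frame (wp_mono (wp_insertCmd hM e0 e4 e5 hx hy rfl h₁ hhull fun a ha =>
      hmono _ _ (hhull.mem a ha).2.le hb) ?_)
    rintro t s₂ ⟨ht, hhull'⟩ hf'
    have e8 : s₂.ivar 8 = s₁.ivar 8 := hf'.ivar 8 (by simp [insertCmd, popCmd, hM.symm])
    simp only [wp_setI, ivar_setI, iarr_setI, if_true, if_neg hM, IExpr.eval, e8]
    refine ⟨⟨by omega, by omega, hhull'⟩, ?_⟩
    simp
    omega
  · rintro t s₁ hf ⟨h₁, h₂, hhull⟩ hb ht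
    have e9 : s₁.ivar 9 = hi := by
      rw [hf.ivar 9 (by simp [insertCmd, popCmd, hM'.symm])]
      simp [hM'.symm, hhi]
    simp only [Test.eval, IExpr.eval, e9] at hb
    obtain rfl : s₁.ivar 8 = hi := by omega
    refine ⟨?_, hhull⟩
    simp [hM.symm, hlo] at ht ⊢
    omega

end RealRAM

/-! ### The two-pointer sweep for one middle point -/

namespace RealRAM

/-- The linear functional of the current left point at the `k`-th point of the right hull. -/
def valExpr (k : IExpr) : RExpr :=
  .add (.mul (.var 11) (.sorted 5 (.get 2 k))) (.mul (.var 12) (.sorted 4 (.get 2 k)))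

/-- The pointer also advances at ties, and it never passes the last hull vertex. -/
def advanceCmd : Cmd :=
  .loop (.conj (.ilt (.add (.var 11) (.const 1)) (.var 7))
      (.neg (.rlt (valExpr (.add (.var 11) (.const 1))) (valExpr (.var 11)))))
    (.setI 11 (.add (.var 11) (.const 1)))

/-- Record the current triangle if it is larger than the recorded one. -/
def recordCmd : Cmd :=
  .cond (.rlt (.var 0) (.var 13))
    (.seq (.setR 0 (.var 13))
    (.seq (.setI 0 (.get 0 (.get 1 (.var 10))))
    (.seq (.setI 1 (.get 0 (.var 4)))
    (.seq (.setI 2 (.get 0 (.get 2 (.var 11))))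
    (.seq (.setR 1 (.get 0 (.var 0)))
    (.seq (.setR 2 (.get 1 (.var 0)))
    (.seq (.setR 3 (.get 2 (.var 1)))
    (.seq (.setR 4 (.get 3 (.var 1)))
    (.seq (.setR 5 (.get 0 (.var 2)))
      (.setR 6 (.get 1 (.var 2))))))))))))
    .skip

/-- Two pointers: the pointer `ivar 10` runs through the left hull, and the pointer `ivar 11` to the
best partner advances on the right hull. -/
def sweepCmd : Cmd :=
  .seq (.setI 10 (.const 0)) (.seq (.setI 11 (.const 0))
    (.loop (.conj (.ilt (.const 0) (.var 7)) (.ilt (.var 10) (.var 6)))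
      (.seq (.setR 11 (.sub (.sorted 4 (.var 4)) (.sorted 4 (.get 1 (.var 10)))))
      (.seq (.setR 12 (.sub (.sorted 5 (.get 1 (.var 10))) (.sorted 6 (.var 4))))
      (.seq advanceCmd
      (.seq (.setR 13 (.add
        (.mul (.var 11) (.sub (.sorted 5 (.get 2 (.var 11))) (.sorted 6 (.var 4))))
        (.mul (.var 12) (.sub (.sorted 4 (.get 2 (.var 11))) (.sorted 4 (.var 4))))))
      (.seq recordCmd (.setI 10 (.add (.var 10) (.const 1))))))))))

/-- For every middle point, build the hulls to its left and to its right, and sweep. -/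
def passCmd : Cmd :=
  .seq (.setI 4 (.const 0))
    (.loop (.ilt (.var 4) (.var 3))
      (.seq (.setI 8 (.const 0))
      (.seq (.setI 9 (.var 4))
      (.seq (hullCmd 1 6)
      (.seq (.setI 8 (.add (.var 4) (.const 1)))
      (.seq (.setI 9 (.var 3))
      (.seq (hullCmd 2 7)
      (.seq sweepCmd (.setI 4 (.add (.var 4) (.const 1)))))))))))

/-- The recorded triangle (its size, the indices of its segments, and its corners) satisfies `W`. -/
def Recorded (W : ℝ → ℕ × ℕ × ℕ → (ℝ × ℝ) × (ℝ × ℝ) × (ℝ × ℝ) → Prop) (s : State) : Prop :=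
  W (s.rvar 0) (s.ivar 0, s.ivar 1, s.ivar 2)
    ((s.rvar 1, s.rvar 2), (s.rvar 3, s.rvar 4), (s.rvar 5, s.rvar 6))

/-- The part of the memory that a pass reads: the number `n` of segments, the sorting permutation
`π`, the transformed coordinates `X, T, B`, and the end points `(a, b)` and `(c, d)`. -/
structure PassInput (n : ℕ) (π : ℕ → ℕ) (X T B a b c d : ℕ → ℝ) (s : State) : Prop where
  n_eq : s.ivar 3 = n
  perm_eq : s.iarr 0 = π
  fst_eq : s.rarr 0 = a
  snd_eq : s.rarr 1 = b
  fst_eq' : s.rarr 2 = c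
  snd_eq' : s.rarr 3 = d
  x_eq : s.rarr 4 = X
  top_eq : s.rarr 5 = T
  bot_eq : s.rarr 6 = B

theorem PassInput.of_frame {n : ℕ} {π : ℕ → ℕ} {X T B a b c d : ℕ → ℝ} {s s' : State}
    (h : PassInput n π X T B a b c d s) {C : Cmd} (hf : Frame C s s') (h3 : 3 ∉ C.ivars)
    (h0 : 0 ∉ C.iarrs) (hr : C.rarrs = []) : PassInput n π X T B a b c d s' :=
  ⟨(hf.ivar _ h3).trans h.n_eq, (hf.iarr _ h0).trans h.perm_eq,
    (hf.rarr _ (by simp [hr])).trans h.fst_eq, (hf.rarr _ (by simp [hr])).trans h.snd_eq,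
    (hf.rarr _ (by simp [hr])).trans h.fst_eq', (hf.rarr _ (by simp [hr])).trans h.snd_eq',
    (hf.rarr _ (by simp [hr])).trans h.x_eq, (hf.rarr _ (by simp [hr])).trans h.top_eq,
    (hf.rarr _ (by simp [hr])).trans h.bot_eq⟩

theorem PassInput.congr {n : ℕ} {π : ℕ → ℕ} {X T B a b c d : ℕ → ℝ} {s s' : State}
    (h : PassInput n π X T B a b c d s) (h3 : s'.ivar 3 = s.ivar 3) (h0 : s'.iarr 0 = s.iarr 0)
    (hr : s'.rarr = s.rarr) : PassInput n π X T B a b c d s' :=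
  ⟨h3.trans h.n_eq, h0.trans h.perm_eq, by rw [hr, h.fst_eq], by rw [hr, h.snd_eq],
    by rw [hr, h.fst_eq'], by rw [hr, h.snd_eq'], by rw [hr, h.x_eq], by rw [hr, h.top_eq],
    by rw [hr, h.bot_eq]⟩

/-- All moves are nondecreasing for the functional, and the stop is at the end or before a decrease;
by `IsConcaveChain.val_le` no later vertex is then better. The cost is charged to the progress of
the pointer, so that it adds up to a linear total over a sweep. -/
theorem wp_advanceCmd {s : State} {x y : ℕ → ℝ} {S : ℕ → ℕ} {m : ℕ} {α β : ℝ}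
    (hx : x = s.rarr 4 ∘ s.iarr 0) (hy : y = s.rarr 5 ∘ s.iarr 0) (hS : s.iarr 2 = S)
    (hm : s.ivar 7 = m) (hα : s.rvar 11 = α) (hβ : s.rvar 12 = β) (hk : s.ivar 11 < m) :
    wp advanceCmd s fun t s' =>
      t + 60 * (m - s'.ivar 11) ≤ 60 * (m - s.ivar 11) + 60 ∧ s.ivar 11 ≤ s'.ivar 11 ∧
      s'.ivar 11 < m ∧
      (∀ q, s.ivar 11 ≤ q → q < s'.ivar 11 →
        α * y (S q) + β * x (S q) ≤ α * y (S (q + 1)) + β * x (S (q + 1))) ∧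
      (s'.ivar 11 + 1 < m → α * y (S (s'.ivar 11 + 1)) + β * x (S (s'.ivar 11 + 1)) ≤
        α * y (S (s'.ivar 11)) + β * x (S (s'.ivar 11))) := by
  refine wp_loop (fun s' => s.ivar 11 ≤ s'.ivar 11 ∧ s'.ivar 11 < m ∧
      (∀ q, s.ivar 11 ≤ q → q < s'.ivar 11 →
        α * y (S q) + β * x (S q) ≤ α * y (S (q + 1)) + β * x (S (q + 1))))
    (fun s' => 60 * (m - s'.ivar 11)) ⟨le_rfl, hk, fun q h₁ h₂ => by omega⟩ ?_ ?_
  · rintro s₁ hf ⟨h₁, h₂, h₃⟩ hb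
    have e7 := hf.ivar 7 (by simp)
    simp only [Test.eval, IExpr.eval, RExpr.eval, valExpr, RExpr.sorted, hf.iarr 0 (by simp),
      hf.iarr 2 (by simp), hf.rarr 4 (by simp), hf.rarr 5 (by simp), hf.rvar 11 (by simp),
      hf.rvar 12 (by simp), e7, hS, hm, hα, hβ, not_lt] at hb
    simp only [wp_setI, ivar_setI, if_true, IExpr.eval]
    refine ⟨⟨by omega, hb.1, fun q hq hq' => ?_⟩, ?_⟩
    · rcases Nat.lt_succ_iff_lt_or_eq.1 hq' with h | rfl
      · exact h₃ q hq h
      · subst hx hy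
        exact hb.2
    · simp [valExpr]
      omega
  · rintro t s₁ hf ⟨h₁, h₂, h₃⟩ hb ht
    have e7 := hf.ivar 7 (by simp)
    simp only [Test.eval, IExpr.eval, RExpr.eval, valExpr, RExpr.sorted, hf.iarr 0 (by simp),
      hf.iarr 2 (by simp), hf.rarr 4 (by simp), hf.rarr 5 (by simp), hf.rvar 11 (by simp),
      hf.rvar 12 (by simp), e7, hS, hm, hα, hβ] at hb
    refine ⟨?_, h₁, h₂, h₃, fun h => ?_⟩
    · simp [valExpr] at ht
      omega
    · subst hx hy
      by_contra hc
      exact hb ⟨h, fun h' => hc h'.le⟩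

/-- The predicate `W` stays abstract, which separates the search from the geometry. The middle
corner is read from the second end points and the outer corners from the first. -/
theorem wp_recordCmd {n : ℕ} {π : ℕ → ℕ} {X T B a b c d : ℕ → ℝ} {s : State}
    (h : PassInput n π X T B a b c d s)
    {W : ℝ → ℕ × ℕ × ℕ → (ℝ × ℝ) × (ℝ × ℝ) × (ℝ × ℝ) → Prop} {i j k : ℕ}
    (hi : π (s.iarr 1 (s.ivar 10)) = i) (hj : π (s.ivar 4) = j)
    (hk : π (s.iarr 2 (s.ivar 11)) = k)
    (hW : W (s.rvar 13) (i, j, k) ((a i, b i), (c j, d j), (a k, b k))) (hs : Recorded W s) :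
    wp recordCmd s fun t s' => t ≤ 60 ∧ Recorded W s' ∧ s.rvar 0 ≤ s'.rvar 0 ∧
      s.rvar 13 ≤ s'.rvar 0 := by
  rw [recordCmd, wp_cond]
  constructor
  · intro hb
    simp only [Test.eval, RExpr.eval] at hb
    simp [Recorded, h.perm_eq, h.fst_eq, h.snd_eq, h.fst_eq', h.snd_eq', hi, hj, hk, hW, hb.le]
  · intro hb
    simp only [Test.eval, RExpr.eval, not_lt] at hb
    simp [hs, hb]

/-- The effect of a sweep with the middle point `j` and the left hull `S`, `m` and the right hull
`S'`, `m'`. -/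
theorem wp_sweepCmd {n : ℕ} {π : ℕ → ℕ} {X T B a b c d x y z : ℕ → ℝ} {s : State}
    (h : PassInput n π X T B a b c d s) (hx : x = X ∘ π) (hy : y = T ∘ π) (hz : z = B ∘ π)
    (hmono : ∀ p q, p ≤ q → q < n → x p ≤ x q) {j : ℕ} (hj : s.ivar 4 = j) (hjn : j < n)
    {S S' : ℕ → ℕ} {m m' : ℕ} (hS : s.iarr 1 = S) (hm : s.ivar 6 = m) (hS' : s.iarr 2 = S')
    (hm' : s.ivar 7 = m') (hl : IsUpperHull x y 0 j S m) (hr : IsUpperHull x y (j + 1) n S' m')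
    {W : ℝ → ℕ × ℕ × ℕ → (ℝ × ℝ) × (ℝ × ℝ) × (ℝ × ℝ) → Prop}
    (hW : ∀ i k, i < j → j < k → k < n → W (areaForm x y z i j k) (π i, π j, π k)
      ((a (π i), b (π i)), (c (π j), d (π j)), (a (π k), b (π k))))
    (hs : Recorded W s) (h0 : 0 ≤ s.rvar 0) :
    wp sweepCmd s fun t s' => t ≤ 400 * (m + m') + 100 ∧ Recorded W s' ∧
      s.rvar 0 ≤ s'.rvar 0 ∧
      ∀ i k, i < j → j < k → k < n → areaForm x y z i j k ≤ s'.rvar 0 := by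
  rw [sweepCmd, wp_seq, wp_setI, wp_seq, wp_setI]
  have hxj : ∀ b < m, x (S b) ≤ x j := fun b hb => hmono _ _ (hl.mem b hb).2.le hjn
  -- Each past move of the right pointer was nondecreasing for some left vertex already visited,
  -- whether or not the left hull is clockwise up to it. The bound on the form is claimed only for
  -- left vertices with a clockwise prefix, as `areaForm_le_of_upperHull` needs no more.
  refine wp_loop (fun s' => Recorded W s' ∧ s.rvar 0 ≤ s'.rvar 0 ∧ s'.ivar 10 ≤ m ∧
      (0 < m' → s'.ivar 11 < m') ∧
      (∀ q < s'.ivar 11, ∃ b ≤ s'.ivar 10, b < m ∧ (x j - x (S b)) * y (S' q) +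
        (y (S b) - z j) * x (S' q) ≤ (x j - x (S b)) * y (S' (q + 1)) +
        (y (S b) - z j) * x (S' (q + 1))) ∧
      (0 < m' → ∀ b < s'.ivar 10, (∀ e < b, Clockwise x y S (x j) (z j) e) → ∀ q < m',
        areaForm x y z (S b) j (S' q) ≤ s'.rvar 0))
    (fun s' => 300 * (m - s'.ivar 10) + 60 * (m' - s'.ivar 11)) ?_ ?_ ?_
  · simp only [Recorded, ivar_setI, rvar_setI, IExpr.eval]
    simp
    exact hs
  · rintro s₁ hf ⟨hs₁, h₁, hm₁, hk₁, hq, hle⟩ hb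
    have hf : Frame sweepCmd s s₁ := by
      refine Frame.trans ?_ (hf.of_subset (d := sweepCmd) (by simp [sweepCmd]) (by simp [sweepCmd])
        (by simp [sweepCmd]) (by simp [sweepCmd]))
      refine ⟨fun x hx => ?_, fun _ _ => rfl, fun _ _ => rfl, fun _ _ => rfl⟩
      simp [sweepCmd] at hx
      simp [hx]
    have hin : PassInput n π X T B a b c d s₁ := h.of_frame hf (by decide) (by decide) (by decide)
    have e4 := (hf.ivar 4 (by decide)).trans hj
    have e6 := (hf.ivar 6 (by decide)).trans hm
    have e7 := (hf.ivar 7 (by decide)).trans hm'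
    have eS := (hf.iarr 1 (by decide)).trans hS
    have eS' := (hf.iarr 2 (by decide)).trans hS'
    simp only [Test.eval, IExpr.eval, e6, e7] at hb
    obtain ⟨hpos, ha⟩ := hb
    rw [wp_seq, wp_setR, wp_seq, wp_setR, wp_seq]
    set i := s₁.ivar 10 with hi
    have hmem := hl.mem i ha
    refine wp_frame (wp_mono (wp_advanceCmd (x := x) (y := y) (S := S') (m := m')
      (α := x j - x (S i)) (β := y (S i) - z j) ?_ ?_ ?_ ?_ ?_ ?_ ?_) ?_)
    · simp [hin.perm_eq, hin.x_eq, hx]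
    · simp [hin.perm_eq, hin.top_eq, hy]
    · simp [eS']
    · simp [e7]
    · simp [hin.perm_eq, hin.x_eq, hx, e4, eS, ← hi]
    · simp [hin.perm_eq, hin.bot_eq, hin.top_eq, hy, hz, e4, eS, ← hi]
    · simpa using hk₁ hpos
    · rintro t s₂ ⟨ht, hle₂, hk₂, hstep, hlast⟩ hf₂
      simp only [ivar_setR] at hle₂ hstep ht
      have hmem' := hr.mem _ hk₂
      have hin₂ : PassInput n π X T B a b c d s₂ :=
        (hin.congr (s' := (s₁.setR 11 _).setR 12 _) rfl rfl rfl).of_frame hf₂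
          (by decide) (by decide) (by decide)
      have f4 : s₂.ivar 4 = j := (hf₂.ivar 4 (by decide)).trans e4
      have f10 : s₂.ivar 10 = i := hf₂.ivar 10 (by decide)
      have fS : s₂.iarr 1 = S := (hf₂.iarr 1 (by decide)).trans eS
      have fS' : s₂.iarr 2 = S' := (hf₂.iarr 2 (by decide)).trans eS'
      have f11 : s₂.rvar 11 = x j - x (S i) := by
        rw [hf₂.rvar 11 (by decide)]
        simp [hin.perm_eq, hin.x_eq, hx, e4, eS, ← hi]
      have f12 : s₂.rvar 12 = y (S i) - z j := by
        rw [hf₂.rvar 12 (by decide)]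
        simp [hin.perm_eq, hin.bot_eq, hin.top_eq, hy, hz, e4, eS, ← hi]
      have fr0 : s₂.rvar 0 = s₁.rvar 0 := by
        rw [hf₂.rvar 0 (by decide)]
        simp
      have hs₂ : Recorded W s₂ := by
        have g (x) (hx : x ≠ 11 ∧ x ≠ 12) : s₂.rvar x = s₁.rvar x := by
          rw [hf₂.rvar x (by simp [advanceCmd])]
          simp [hx]
        have g' (x) (hx : x ≠ 11) : s₂.ivar x = s₁.ivar x := by
          rw [hf₂.ivar x (by simp [advanceCmd, hx])]
          simp
        simpa [Recorded, g, g'] using hs₁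
      have fval : (RExpr.add
          (.mul (.var 11) (.sub (.sorted 5 (.get 2 (.var 11))) (.sorted 6 (.var 4))))
          (.mul (.var 12) (.sub (.sorted 4 (.get 2 (.var 11))) (.sorted 4 (.var 4))))).eval s₂ =
          areaForm x y z (S i) j (S' (s₂.ivar 11)) := by
        simp [f11, f12, hin₂.perm_eq, hin₂.x_eq, hin₂.top_eq, hin₂.bot_eq, f4, fS', areaForm,
          hx, hy, hz]
      rw [wp_seq, wp_setR, fval, wp_seq]
      refine wp_frame (wp_mono (wp_recordCmd (W := W) (i := π (S i)) (j := π j) (k := π (S' (s₂.ivar 11)))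
        (hin₂.congr (s' := s₂.setR 13 _) rfl rfl rfl) ?_ ?_ ?_ ?_ ?_) ?_)
      · simp [fS, f10]
      · simp [f4]
      · simp [fS']
      · simpa using hW _ _ hmem.2 (by omega) hmem'.2
      · simpa [Recorded] using hs₂
      · rintro t' s₃ ⟨ht', hs₃, hr₀, hr₁⟩ hf₃
        simp only [rvar_setR, fr0] at hr₀ hr₁
        norm_num at hr₀ hr₁
        have g10 : s₃.ivar 10 = i := (hf₃.ivar 10 (by decide)).trans f10
        have g11 : s₃.ivar 11 = s₂.ivar 11 := hf₃.ivar 11 (by decide)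
        simp only [wp_setI, ivar_setI, rvar_setI, IExpr.eval, g10, g11, if_true]
        norm_num
        refine ⟨⟨by simpa [Recorded] using hs₃, h₁.trans hr₀, by omega, fun _ => hk₂, ?_, ?_⟩, ?_⟩
        · intro q hq'
          by_cases hq'' : q < s₁.ivar 11
          · obtain ⟨b, hb, hb'⟩ := hq q hq''
            exact ⟨b, by omega, hb'⟩
          · exact ⟨i, by omega, ha, hstep q (by omega) hq'⟩
        · intro _ b hb hcw q hq'
          by_cases hbi : b < i
          · exact (hle hpos b hbi hcw q hq').trans hr₀
          obtain rfl : b = i := by omega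
          refine le_trans ?_ hr₁
          -- Moves made for earlier left vertices are nondecreasing for the present one too, by
          -- `IsConcaveChain.val_mono` along the clockwise prefix. So the functional rises up to the
          -- pointer and does not exceed its value there afterwards.
          have hup : ∀ q, q < s₂.ivar 11 → (x j - x (S i)) * y (S' q) +
              (y (S i) - z j) * x (S' q) ≤ (x j - x (S i)) * y (S' (q + 1)) +
              (y (S i) - z j) * x (S' (q + 1)) := by
            intro q hq₂
            by_cases hq'' : q < s₁.ivar 11
            · obtain ⟨e, he, -, he'⟩ := hq q hq''
              exact hl.val_mono hxj he ha hcw (hr.lt q (by omega)).le he'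
            · exact hstep q (by omega) hq₂
          have hmax : (x j - x (S i)) * y (S' q) + (y (S i) - z j) * x (S' q) ≤
              (x j - x (S i)) * y (S' (s₂.ivar 11)) + (y (S i) - z j) * x (S' (s₂.ivar 11)) := by
            rcases le_total (s₂.ivar 11) q with hc | hc
            · exact hr.val_le (sub_nonneg.2 (hxj i ha)) hlast hc hq'
            · have : ∀ e, q ≤ e → e ≤ s₂.ivar 11 →
                  (x j - x (S i)) * y (S' q) + (y (S i) - z j) * x (S' q) ≤
                  (x j - x (S i)) * y (S' e) + (y (S i) - z j) * x (S' e) := by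
                intro e he
                induction e, he using Nat.le_induction with
                | base => exact fun _ => le_rfl
                | succ e he ih => exact fun h => (ih (by omega)).trans (hup e (by omega))
              exact this _ hc le_rfl
          unfold areaForm
          linarith
        · have := hk₁ hpos
          simp
          omega
  · rintro t s₁ hf ⟨hs₁, h₁, hm₁, hk₁, hq, hle⟩ hb ht
    have e6 : s₁.ivar 6 = m := by
      rw [hf.ivar 6 (by decide)]
      simp [hm]
    have e7 : s₁.ivar 7 = m' := by
      rw [hf.ivar 7 (by decide)]
      simp [hm']
    simp only [Test.eval, IExpr.eval, e6, e7] at hb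
    refine ⟨?_, hs₁, h₁, fun i k hij hjk hk => ?_⟩
    · simp at ht ⊢
      omega
    · have hpos : 0 < m' := by
        -- The zero functional serves only to extract a vertex, showing that the right hull is
        -- nonempty.
        obtain ⟨_, ⟨q, hq, -⟩, -⟩ := hr.dom k hjk hk 0 0 le_rfl
        omega
      exact areaForm_le_of_upperHull (h0.trans h₁) hmono hjn hl hr
        (fun b hb' hcw q hq' => hle hpos b (by omega) hcw q hq') hij hjk hk

end RealRAM

/-- Abscissas increase strictly along the chain, so no point number repeats. This turns the sweep's
cost in hull vertices into a cost in n. -/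
theorem IsUpperHull.size_le {x y : ℕ → ℝ} {lo hi m : ℕ} {S : ℕ → ℕ}
    (h : IsUpperHull x y lo hi S m) : m ≤ hi - lo := by
  have hlt {a b : ℕ} (hab : a < b) (hb : b < m) : x (S a) < x (S b) := by
    induction b, hab using Nat.le_induction with
    | base => exact h.lt a hb
    | succ b _ ih => exact (ih (by omega)).trans (h.lt b hb)
  have := Finset.card_le_card_of_injOn S (s := Finset.range m) (t := Finset.Ico lo hi)
    (fun a ha => by simpa using h.mem a (by simpa using ha)) (by
      intro a ha b hb hab
      simp only [Finset.coe_range, Set.mem_Iio] at ha hb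
      rcases lt_trichotomy a b with hc | hc | hc
      · exact absurd (congrArg x hab) (hlt hc hb).ne
      · exact hc
      · exact absurd (congrArg x hab) (hlt hc ha).ne')
  simpa using this

/-! ### A pass over all middle points -/

namespace RealRAM

theorem wp_passCmd {n : ℕ} {π : ℕ → ℕ} {X T B a b c d x y z : ℕ → ℝ} {s : State}
    (h : PassInput n π X T B a b c d s) (hx : x = X ∘ π) (hy : y = T ∘ π) (hz : z = B ∘ π)
    (hmono : ∀ p q, p ≤ q → q < n → x p ≤ x q)
    {W : ℝ → ℕ × ℕ × ℕ → (ℝ × ℝ) × (ℝ × ℝ) × (ℝ × ℝ) → Prop}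
    (hW : ∀ i j k, i < j → j < k → k < n → W (areaForm x y z i j k) (π i, π j, π k)
      ((a (π i), b (π i)), (c (π j), d (π j)), (a (π k), b (π k))))
    (hs : Recorded W s) (h0 : 0 ≤ s.rvar 0) :
    wp passCmd s fun t s' => t ≤ (2000 * n + 1000) * n + 10 ∧ Recorded W s' ∧
      s.rvar 0 ≤ s'.rvar 0 ∧
      ∀ i j k, i < j → j < k → k < n → areaForm x y z i j k ≤ s'.rvar 0 := by
  rw [passCmd, wp_seq, wp_setI]
  refine wp_loop_counted (fun s' => Recorded W s' ∧ s.rvar 0 ≤ s'.rvar 0 ∧ s'.ivar 4 ≤ n ∧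
      ∀ i j k, i < j → j < k → k < n → j < s'.ivar 4 → areaForm x y z i j k ≤ s'.rvar 0)
    -- A round costs at most 500 per point for the scans and 400 per hull vertex for the sweep, plus
    -- constants; both sides together have fewer than n points.
    (fun s' => n - s'.ivar 4) (2000 * n + 1000) ?_ ?_ ?_
  · simpa [Recorded] using hs
  · rintro s₁ hf ⟨hs₁, h₁, hn₁, hle⟩ hb
    have hin : PassInput n π X T B a b c d s₁ :=
      (h.congr (s' := s.setI 4 _) rfl rfl rfl).of_frame hf (by decide) (by decide) (by decide)
    simp only [Test.eval, IExpr.eval, hin.n_eq] at hb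
    set j := s₁.ivar 4 with hj
    rw [wp_seq, wp_setI, wp_seq, wp_setI, wp_seq]
    have hin₁ : PassInput n π X T B a b c d
        ((s₁.setI 8 (IExpr.eval s₁ (.const 0))).setI 9
          (IExpr.eval (s₁.setI 8 (IExpr.eval s₁ (.const 0))) (.var 4))) :=
      hin.congr rfl rfl rfl
    refine wp_frame (wp_mono (wp_hullCmd (lo := 0) (hi := j) (by decide) (by decide) (by decide)
      hin₁.perm_eq hin₁.x_eq hin₁.top_eq hx hy (by simp) (by simp [hj]) (Nat.zero_le _)
      fun p q hpq hq => hmono p q hpq (by omega)) ?_)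
    rintro t₂ s₂ ⟨ht₂, hl⟩ hf₂
    have hin₂ : PassInput n π X T B a b c d s₂ :=
      hin₁.of_frame hf₂ (by decide) (by decide) (by decide)
    have hj₂ : s₂.ivar 4 = j := hf₂.ivar 4 (by decide)
    rw [wp_seq, wp_setI, wp_seq, wp_setI, wp_seq]
    have hin₃ : PassInput n π X T B a b c d
        ((s₂.setI 8 (IExpr.eval s₂ (.add (.var 4) (.const 1)))).setI 9
          (IExpr.eval (s₂.setI 8 (IExpr.eval s₂ (.add (.var 4) (.const 1)))) (.var 3))) :=
      hin₂.congr rfl rfl rfl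
    refine wp_frame (wp_mono (wp_hullCmd (lo := j + 1) (hi := n) (by decide) (by decide)
      (by decide) hin₃.perm_eq hin₃.x_eq hin₃.top_eq hx hy (by simp [hj₂]) (by simp [hin₂.n_eq])
      hb hmono) ?_)
    rintro t₄ s₄ ⟨ht₄, hr⟩ hf₄
    have hin₄ : PassInput n π X T B a b c d s₄ :=
      hin₃.of_frame hf₄ (by decide) (by decide) (by decide)
    have hj₄ : s₄.ivar 4 = j := (hf₄.ivar 4 (by decide)).trans hj₂
    have e1 : s₄.iarr 1 = s₂.iarr 1 := hf₄.iarr 1 (by decide)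
    have e6 : s₄.ivar 6 = s₂.ivar 6 := hf₄.ivar 6 (by decide)
    have hrv : s₄.rvar = s₁.rvar := by
      funext x
      rw [hf₄.rvar x (by simp [hullCmd, insertCmd, popCmd])]
      simp only [rvar_setI]
      rw [hf₂.rvar x (by simp [hullCmd, insertCmd, popCmd])]
      simp
    have hiv (x) (hx : x < 3) : s₄.ivar x = s₁.ivar x := by
      have g : x ≠ 6 ∧ x ≠ 7 ∧ x ≠ 8 ∧ x ≠ 9 := by omega
      rw [hf₄.ivar x (by simp [hullCmd, insertCmd, popCmd, g])]
      simp only [ivar_setI, g, if_false]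
      rw [hf₂.ivar x (by simp [hullCmd, insertCmd, popCmd, g])]
      simp [g]
    have hs₄ : Recorded W s₄ := by
      simpa [Recorded, hrv, hiv] using hs₁
    rw [wp_seq]
    refine wp_frame (wp_mono (wp_sweepCmd (W := W) hin₄ hx hy hz hmono hj₄ hb e1 e6 rfl rfl hl hr
      (fun i k hij hjk hk => hW i j k hij hjk hk) hs₄ (by rw [hrv]; exact h0.trans h₁)) ?_)
    rintro t₅ s₅ ⟨ht₅, hs₅, h₅, hle₅⟩ hf₅
    have hj₅ : s₅.ivar 4 = j := (hf₅.ivar 4 (by decide)).trans hj₄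
    rw [hrv] at h₅
    simp only [wp_setI, ivar_setI, rvar_setI, IExpr.eval, hj₅, if_true]
    have hm := hl.size_le
    have hm' := hr.size_le
    refine ⟨⟨by simpa [Recorded] using hs₅, h₁.trans h₅, hb, fun i j' k hij hjk hk hj' => ?_⟩,
      by omega, ?_⟩
    · rcases Nat.lt_succ_iff_lt_or_eq.1 hj' with hj' | rfl
      · exact (hle i j' k hij hjk hk hj').trans h₅
      · exact hle₅ i k hij hjk hk
    · simp
      omega
  · rintro t s₁ hf ⟨hs₁, h₁, hn₁, hle⟩ hb ht
    have hin : PassInput n π X T B a b c d s₁ :=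
      (h.congr (s' := s.setI 4 _) rfl rfl rfl).of_frame hf (by decide) (by decide) (by decide)
    simp only [Test.eval, IExpr.eval, hin.n_eq] at hb
    refine ⟨?_, hs₁, h₁, fun i j k hij hjk hk => hle i j k hij hjk hk (by omega)⟩
    simp at ht ⊢
    omega

/-! ### Sorting -/

def swapCmd : Cmd :=
  .seq (.setI 15 (.get 0 (.var 13)))
    (.seq (.putI 0 (.var 13) (.get 0 (.var 14))) (.putI 0 (.var 14) (.var 15)))

/-- One round of exchange sort: bring the smallest remaining element to position `ivar 13`. -/
def selectCmd : Cmd :=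
  .seq (.setI 14 (.add (.var 13) (.const 1)))
    (.loop (.ilt (.var 14) (.var 3))
      (.seq (.cond (.rlt (.sorted 4 (.var 14)) (.sorted 4 (.var 13))) swapCmd .skip)
        (.setI 14 (.add (.var 14) (.const 1)))))

/-- Put into the integer array `0` a permutation sorting the real array `4`. -/
def sortCmd : Cmd :=
  .seq (.setI 13 (.const 0))
  (.seq (.loop (.ilt (.var 13) (.var 3))
      (.seq (.putI 0 (.var 13) (.var 13)) (.setI 13 (.add (.var 13) (.const 1)))))
  (.seq (.setI 13 (.const 0))
    (.loop (.ilt (.var 13) (.var 3)) (.seq selectCmd (.setI 13 (.add (.var 13) (.const 1)))))))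

/-- `π` permutes the numbers below `n`. -/
structure PermutesBelow (n : ℕ) (π : ℕ → ℕ) : Prop where
  lt : ∀ p < n, π p < n
  inj : ∀ p < n, ∀ q < n, π p = π q → p = q

theorem PermutesBelow.exists_eq {n : ℕ} {π : ℕ → ℕ} (h : PermutesBelow n π) {i : ℕ} (hi : i < n) :
    ∃ p < n, π p = i := by
  have := Finset.surjOn_of_injOn_of_card_le (s := Finset.range n) (t := Finset.range n) π
    (fun p hp => by simpa using h.lt p (by simpa using hp))
    (fun p hp q hq => h.inj p (by simpa using hp) q (by simpa using hq)) le_rfl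
  obtain ⟨p, hp, hpi⟩ := this (show i ∈ _ by simpa using hi)
  exact ⟨p, by simpa using hp, hpi⟩

theorem update_update_eq_comp_swap (π : ℕ → ℕ) (i j : ℕ) :
    Function.update (Function.update π i (π j)) j (π i) = π ∘ Equiv.swap i j := by
  funext p
  simp only [Function.update_apply, Function.comp_apply, Equiv.swap_apply_def]
  split_ifs <;> simp_all

theorem PermutesBelow.swap {n : ℕ} {π : ℕ → ℕ} (h : PermutesBelow n π) {i j : ℕ} (hi : i < n)
    (hj : j < n) : PermutesBelow n (π ∘ Equiv.swap i j) := by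
  have key : ∀ p < n, Equiv.swap i j p < n := fun p hp => by
    rw [Equiv.swap_apply_def]
    split_ifs <;> assumption
  exact ⟨fun p hp => h.lt _ (key p hp), fun p hp q hq hpq =>
    (Equiv.swap i j).injective (h.inj _ (key p hp) _ (key q hq) hpq)⟩

/-- The first `i` positions hold the `i` smallest elements in increasing order. -/
def SortedTo (X : ℕ → ℝ) (n i : ℕ) (π : ℕ → ℕ) : Prop :=
  ∀ a < i, ∀ b, a ≤ b → b < n → X (π a) ≤ X (π b)

theorem SortedTo.swap {X : ℕ → ℝ} {n i j : ℕ} {π : ℕ → ℕ} (h : SortedTo X n i π) (hij : i < j)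
    (hj : j < n) : SortedTo X n i (π ∘ Equiv.swap i j) := by
  intro a ha b hab hb
  simp only [Function.comp_apply, Equiv.swap_apply_def]
  rw [if_neg (by omega), if_neg (by omega)]
  split_ifs <;> exact h a ha _ (by omega) (by omega)

/-- Position `i` holds the minimum over the positions from `i` up to the scanning index; exchanges
involve only `i` and later positions, so the sorted prefix survives. -/
theorem wp_selectCmd {n i : ℕ} {s : State} (hn : s.ivar 3 = n) (hi : s.ivar 13 = i) (hin : i < n)
    (hperm : PermutesBelow n (s.iarr 0)) (hsort : SortedTo (s.rarr 4) n i (s.iarr 0)) :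
    wp selectCmd s fun t s' => t ≤ 50 * n + 10 ∧ PermutesBelow n (s'.iarr 0) ∧
      SortedTo (s.rarr 4) n (i + 1) (s'.iarr 0) := by
  rw [selectCmd, wp_seq, wp_setI]
  refine wp_loop_counted (fun s' => PermutesBelow n (s'.iarr 0) ∧
    SortedTo (s.rarr 4) n i (s'.iarr 0) ∧ i < s'.ivar 14 ∧ s'.ivar 14 ≤ n ∧
    ∀ b, i ≤ b → b < s'.ivar 14 → s.rarr 4 (s'.iarr 0 i) ≤ s.rarr 4 (s'.iarr 0 b))
    (fun s' => n - s'.ivar 14) 50 ?_ ?_ ?_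
  · simp only [iarr_setI, ivar_setI, if_true, IExpr.eval, hi]
    refine ⟨hperm, hsort, by omega, hin, fun b h₁ h₂ => ?_⟩
    obtain rfl : b = i := by omega
    exact le_rfl
  · rintro s₁ hf ⟨hp, hs, hij, hjn, hle⟩ hb
    have e3 : s₁.ivar 3 = n := by
      rw [hf.ivar 3 (by decide)]
      simp [hn]
    have e13 : s₁.ivar 13 = i := by
      rw [hf.ivar 13 (by decide)]
      simp [hi]
    have e4 : s₁.rarr 4 = s.rarr 4 := hf.rarr 4 (by decide)
    simp only [Test.eval, IExpr.eval, e3] at hb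
    rw [wp_seq, wp_cond]
    set j := s₁.ivar 14 with hj
    set ρ := s₁.iarr 0 with hρ
    constructor
    · intro hc
      simp only [Test.eval, IExpr.eval, RExpr.eval, RExpr.sorted, e4, e13, ← hj, ← hρ] at hc
      simp [swapCmd, e13, ← hj, ← hρ, update_update_eq_comp_swap]
      refine ⟨⟨hp.swap hin hb, hs.swap hij hb, by omega, hb, fun b h₁ h₂ => ?_⟩, by omega⟩
      rw [Equiv.swap_apply_def]
      split_ifs with h₃ h₄
      · exact le_rfl
      · exact hc.le
      · exact hc.le.trans (hle b h₁ (by omega))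
    · intro hc
      simp only [Test.eval, IExpr.eval, RExpr.eval, RExpr.sorted, e4, e13, ← hj, ← hρ,
        not_lt] at hc
      simp [← hj, ← hρ]
      refine ⟨⟨hp, hs, by omega, hb, fun b h₁ h₂ => ?_⟩, by omega⟩
      rcases h₂.lt_or_eq with h₂ | rfl
      · exact hle b h₁ h₂
      · exact hc
  · rintro t s₁ hf ⟨hp, hs, hij, hjn, hle⟩ hb ht
    have e3 : s₁.ivar 3 = n := by
      rw [hf.ivar 3 (by decide)]
      simp [hn]
    simp only [Test.eval, IExpr.eval, e3] at hb
    refine ⟨?_, hp, fun a ha b hab hb => ?_⟩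
    · simp at ht ⊢
      omega
    · rcases Nat.lt_succ_iff_lt_or_eq.1 ha with ha | rfl
      · exact hs a ha b hab hb
      · exact hle b hab (by omega)

/-- A quadratic sort suffices, as the passes are quadratic anyway. -/
theorem wp_sortCmd {n : ℕ} {s : State} (hn : s.ivar 3 = n) :
    wp sortCmd s fun t s' => t ≤ (50 * n + 100) * n + 100 ∧ PermutesBelow n (s'.iarr 0) ∧
      SortedTo (s.rarr 4) n n (s'.iarr 0) := by
  rw [sortCmd, wp_seq, wp_setI, wp_seq]
  refine wp_frame (wp_loop_counted (fun s' => s'.ivar 13 ≤ n ∧ ∀ p < s'.ivar 13, s'.iarr 0 p = p)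
    (fun s' => n - s'.ivar 13) 50 ?_ ?_ ?_)
  · simp
  · rintro s₁ hf ⟨hi, hp⟩ hb
    have e3 : s₁.ivar 3 = n := by
      rw [hf.ivar 3 (by decide)]
      simp [hn]
    simp only [Test.eval, IExpr.eval, e3] at hb
    simp
    refine ⟨⟨hb, fun p h₁ => ?_⟩, by omega⟩
    by_cases hpi : p = s₁.ivar 13
    · rw [hpi]
      simp
    · rw [Function.update_of_ne hpi]
      exact hp p (by omega)
  · rintro t s₁ hf ⟨hi, hp⟩ hb ht hf'
    have e3 : s₁.ivar 3 = n := by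
      rw [hf.ivar 3 (by decide)]
      simp [hn]
    have e4 : s₁.rarr 4 = s.rarr 4 := hf.rarr 4 (by decide)
    simp only [Test.eval, IExpr.eval, e3] at hb
    rw [wp_seq, wp_setI]
    refine wp_loop_counted (fun s' => s'.ivar 13 ≤ n ∧ PermutesBelow n (s'.iarr 0) ∧
      SortedTo (s.rarr 4) n (s'.ivar 13) (s'.iarr 0))
      (fun s' => n - s'.ivar 13) (50 * n + 50) ?_ ?_ ?_
    · simp
      refine ⟨⟨fun p h => ?_, fun p h q h' => ?_⟩, fun a ha => absurd ha (Nat.not_lt_zero a)⟩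
      · rw [hp p (by omega)]
        exact h
      · rw [hp p (by omega), hp q (by omega)]
        exact id
    · rintro s₂ hf₂ ⟨hi₂, hp₂, hs₂⟩ hb₂
      have f3 : s₂.ivar 3 = n := by
        rw [hf₂.ivar 3 (by decide)]
        simp [e3]
      have f4 : s₂.rarr 4 = s.rarr 4 := (hf₂.rarr 4 (by decide)).trans e4
      simp only [Test.eval, IExpr.eval, f3] at hb₂
      rw [← f4] at hs₂
      rw [wp_seq]
      refine wp_frame (wp_mono (wp_selectCmd f3 rfl hb₂ hp₂ hs₂) ?_)
      rintro t₃ s₃ ⟨ht₃, hp₃, hs₃⟩ hf₃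
      rw [f4] at hs₃
      have g13 : s₃.ivar 13 = s₂.ivar 13 := hf₃.ivar 13 (by decide)
      simp [g13]
      exact ⟨⟨hb₂, hp₃, hs₃⟩, by omega, by omega⟩
    · rintro t₂ s₂ hf₂ ⟨hi₂, hp₂, hs₂⟩ hb₂ ht₂
      have f3 : s₂.ivar 3 = n := by
        rw [hf₂.ivar 3 (by decide)]
        simp [e3]
      simp only [Test.eval, IExpr.eval, f3] at hb₂
      obtain hi₂ : s₂.ivar 13 = n := by omega
      rw [hi₂] at hs₂
      refine ⟨?_, hp₂, hs₂⟩
      simp at ht ht₂ ⊢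
      ring_nf at ht ht₂ ⊢
      omega

end RealRAM

/-! ### Geometry -/

/-- The coordinate of `a` across the direction `v`. -/
def across (v a : ℝ × ℝ) : ℝ := v.1 * a.2 - v.2 * a.1

/-- The coordinate of `a` along the direction `v`. -/
def along (v a : ℝ × ℝ) : ℝ := v.1 * a.1 + v.2 * a.2

theorem triArea_swap_left (a b c : ℝ × ℝ) : triArea b a c = triArea a b c := by
  unfold triArea
  rw [← abs_neg]
  congr 2
  ring

theorem triArea_swap_right (a b c : ℝ × ℝ) : triArea a c b = triArea a b c := by
  unfold triArea
  rw [← abs_neg]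
  congr 2
  ring

/-- The area form in the coordinates `across v` and `along v` is a multiple of the signed area. -/
theorem abs_area_coords (v a b c : ℝ × ℝ) :
    |(across v b - across v a) * (along v c - along v b) +
      (along v a - along v b) * (across v c - across v b)| =
    (v.1 ^ 2 + v.2 ^ 2) * (2 * triArea a b c) := by
  -- The passage to the coordinates across and along `v` scales lengths by |v| and reverses the
  -- orientation, so its determinant is -|v|².
  have h : (across v b - across v a) * (along v c - along v b) +
      (along v a - along v b) * (across v c - across v b) =
      (v.1 ^ 2 + v.2 ^ 2) *
        -((b.1 - a.1) * (c.2 - a.2) - (c.1 - a.1) * (b.2 - a.2)) := by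
    unfold across along
    ring
  rw [h, abs_mul, abs_neg, abs_of_nonneg (by positivity), triArea]
  ring

theorem along_neg (v a : ℝ × ℝ) : along (-v) a = -along v a := by
  simp [along]
  ring

theorem across_eq_along_mem_of_mem_segment {v w t b a : ℝ × ℝ} (h : a ∈ segment ℝ t b)
    (hv : across v t = across v b) (hw : along w b ≤ along w t) :
    across v a = across v t ∧ along w b ≤ along w a ∧ along w a ≤ along w t := by
  obtain ⟨p, q, hp, hq, hpq, rfl⟩ := h
  obtain rfl : p = 1 - q := by linarith
  have h1 : across v ((1 - q) • t + q • b) = (1 - q) * across v t + q * across v b := by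
    simp [across]
    ring
  have h2 : along w ((1 - q) • t + q • b) = (1 - q) * along w t + q * along w b := by
    simp [along]
    ring
  rw [h1, h2, hv]
  refine ⟨by ring, ?_, ?_⟩ <;> nlinarith

namespace RealRAM

variable {n : ℕ} {L : Fin n → Seg}

/-- The first end point of the `i`-th segment in memory. -/
def State.fst (s : State) (i : ℕ) : ℝ × ℝ := (s.rarr 0 i, s.rarr 1 i)

/-- The second end point of the `i`-th segment in memory. -/
def State.snd (s : State) (i : ℕ) : ℝ × ℝ := (s.rarr 2 i, s.rarr 3 i)

/-- The real arrays `0, 1, 2, 3` hold the end points of the segments, in any order. -/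
def HoldsSegments (L : Fin n → Seg) (s : State) : Prop :=
  ∀ i : Fin n, (s.fst i = (L i).p ∧ s.snd i = (L i).q) ∨ (s.fst i = (L i).q ∧ s.snd i = (L i).p)

/-- The `i`-th segment is stored with its first end point the farther one in direction `w`, and its
coordinates across `v` and along `w` are known. -/
structure Normalized (v w : ℝ × ℝ) (s : State) (i : ℕ) : Prop where
  across_eq : s.rarr 4 i = across v (s.fst i)
  along_fst : s.rarr 5 i = along w (s.fst i)
  along_snd : s.rarr 6 i = along w (s.snd i)
  le : along w (s.snd i) ≤ along w (s.fst i)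

theorem HoldsSegments.carrier_eq {s : State} (h : HoldsSegments L s) (i : Fin n) :
    (L i).carrier = segment ℝ (s.fst i) (s.snd i) := by
  rcases h i with ⟨h₁, h₂⟩ | ⟨h₁, h₂⟩ <;> rw [h₁, h₂, Seg.carrier]
  exact segment_symm ℝ _ _

theorem HoldsSegments.across_eq {s : State} (h : HoldsSegments L s) {v : ℝ × ℝ}
    (hv : ∀ i, across v (L i).p = across v (L i).q) (i : Fin n) :
    across v (s.fst i) = across v (s.snd i) := by
  rcases h i with ⟨h₁, h₂⟩ | ⟨h₁, h₂⟩ <;> rw [h₁, h₂, hv]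

/-! ### The common direction -/

/-- Does the `ivar 16`-th segment have length zero? -/
def degenerateTest : Test :=
  .conj (.conj (.neg (.rlt (.get 0 (.var 16)) (.get 2 (.var 16))))
      (.neg (.rlt (.get 2 (.var 16)) (.get 0 (.var 16)))))
    (.conj (.neg (.rlt (.get 1 (.var 16)) (.get 3 (.var 16))))
      (.neg (.rlt (.get 3 (.var 16)) (.get 1 (.var 16)))))

/-- The last segment of positive length determines the direction; the default (0, 1) remains when
all segments are points, and then any nonzero direction will do. -/
def directionCmd : Cmd :=
  .seq (.setR 7 (.const 0)) (.seq (.setR 8 (.const 1)) (.seq (.setI 16 (.const 0))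
    (.loop (.ilt (.var 16) (.var 3))
      (.seq (.cond degenerateTest .skip
        (.seq (.setR 7 (.sub (.get 2 (.var 16)) (.get 0 (.var 16))))
          (.setR 8 (.sub (.get 3 (.var 16)) (.get 1 (.var 16))))))
      (.setI 16 (.add (.var 16) (.const 1)))))))

theorem _root_.ParallelFamily.across_sub (h : ParallelFamily L) (i j : Fin n) :
    across ((L i).q - (L i).p) (L j).p = across ((L i).q - (L i).p) (L j).q := by
  obtain ⟨v, -, hv⟩ := h
  obtain ⟨c, hc⟩ := hv i
  obtain ⟨d, hd⟩ := hv j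
  rw [hc, ← sub_eq_zero]
  have h1 := congrArg Prod.fst hd
  have h2 := congrArg Prod.snd hd
  simp only [Prod.fst_sub, Prod.snd_sub, Prod.smul_fst, Prod.smul_snd, smul_eq_mul] at h1 h2
  simp only [across, Prod.smul_fst, Prod.smul_snd, smul_eq_mul]
  linear_combination c * v.2 * h1 - c * v.1 * h2

theorem wp_directionCmd (hL : ParallelFamily L) {s : State} (hn : s.ivar 3 = n)
    (hp : ∀ i : Fin n, s.fst i = (L i).p) (hq : ∀ i : Fin n, s.snd i = (L i).q) :
    wp directionCmd s fun t s' => t ≤ 100 * n + 20 ∧ (s'.rvar 7, s'.rvar 8) ≠ 0 ∧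
      ∀ i, across (s'.rvar 7, s'.rvar 8) (L i).p = across (s'.rvar 7, s'.rvar 8) (L i).q := by
  rw [directionCmd, wp_seq, wp_setR, wp_seq, wp_setR, wp_seq, wp_setI]
  refine wp_loop_counted (fun s' => s'.ivar 16 ≤ n ∧ (s'.rvar 7, s'.rvar 8) ≠ 0 ∧
      ∀ i : Fin n, i < s'.ivar 16 →
        across (s'.rvar 7, s'.rvar 8) (L i).p = across (s'.rvar 7, s'.rvar 8) (L i).q)
    (fun s' => n - s'.ivar 16) 100 ?_ ?_ ?_
  · simp
  · rintro s₁ hf ⟨hi, hv, hle⟩ hb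
    have e3 : s₁.ivar 3 = n := by
      rw [hf.ivar 3 (by decide)]
      simp [hn]
    have er : s₁.rarr = s.rarr := by
      funext x
      exact hf.rarr x (by simp)
    simp only [Test.eval, IExpr.eval, e3] at hb
    have hp' := hp ⟨_, hb⟩
    have hq' := hq ⟨_, hb⟩
    simp only [State.fst, State.snd, Prod.ext_iff] at hp' hq'
    rw [wp_seq, wp_cond]
    constructor
    · intro hc
      simp [degenerateTest, er, hp', hq'] at hc
      obtain ⟨⟨h1, h2⟩, h3, h4⟩ := hc
      simp [degenerateTest]
      refine ⟨⟨hb, by simpa using hv, fun i hi' => ?_⟩, by omega⟩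
      rcases hi'.lt_or_eq with hi' | hi'
      · exact hle i hi'
      · obtain rfl : i = ⟨_, hb⟩ := Fin.ext hi'
        rw [Prod.ext (le_antisymm h2 h1) (le_antisymm h4 h3)]
    · intro hc
      simp [degenerateTest, er, hp', hq'] at hc
      simp [degenerateTest, er, hp', hq']
      -- A new direction replaces the old one, so earlier segments must be checked again;
      -- parallelism covers all segments at once.
      refine ⟨⟨hb, fun h1 h2 => ?_, fun i hi' => hL.across_sub ⟨_, hb⟩ i⟩, by omega⟩
      rw [sub_eq_zero] at h1 h2
      exact absurd (hc h1.le h1.ge h2.le) (not_lt.2 h2.ge)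
  · rintro t s₁ hf ⟨hi, hv, hle⟩ hb ht
    have e3 : s₁.ivar 3 = n := by
      rw [hf.ivar 3 (by decide)]
      simp [hn]
    simp only [Test.eval, IExpr.eval, e3] at hb
    refine ⟨?_, hv, fun i => hle i (by omega)⟩
    simp at ht ⊢
    omega

/-! ### Normalization -/

def alongExpr (a b : ℕ) : RExpr :=
  .add (.mul (.var 9) (.get a (.var 16))) (.mul (.var 10) (.get b (.var 16)))

def swapEndsCmd : Cmd :=
  .seq (.setR 14 (.get 0 (.var 16)))
  (.seq (.putR 0 (.var 16) (.get 2 (.var 16)))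
  (.seq (.putR 2 (.var 16) (.var 14))
  (.seq (.setR 14 (.get 1 (.var 16)))
  (.seq (.putR 1 (.var 16) (.get 3 (.var 16)))
    (.putR 3 (.var 16) (.var 14))))))

/-- Order the end points of all segments in the direction `(rvar 9, rvar 10)`, and compute the
coordinates along it and across `(rvar 7, rvar 8)`. -/
def normalizeCmd : Cmd :=
  .seq (.setI 16 (.const 0))
    (.loop (.ilt (.var 16) (.var 3))
      (.seq (.cond (.rlt (alongExpr 0 1) (alongExpr 2 3)) swapEndsCmd .skip)
      (.seq (.putR 4 (.var 16) (.sub (.mul (.var 7) (.get 1 (.var 16)))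
        (.mul (.var 8) (.get 0 (.var 16)))))
      (.seq (.putR 5 (.var 16) (alongExpr 0 1))
      (.seq (.putR 6 (.var 16) (alongExpr 2 3))
        (.setI 16 (.add (.var 16) (.const 1))))))))

/-- Assuming only `HoldsSegments` allows a second use with the reversed direction, after the first
has exchanged end points. -/
theorem wp_normalizeCmd {v w : ℝ × ℝ} {s : State} (hn : s.ivar 3 = n)
    (hv : (s.rvar 7, s.rvar 8) = v) (hw : (s.rvar 9, s.rvar 10) = w) (hs : HoldsSegments L s) :
    wp normalizeCmd s fun t s' => t ≤ 200 * n + 20 ∧ HoldsSegments L s' ∧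
      ∀ i < n, Normalized v w s' i := by
  rw [normalizeCmd, wp_seq, wp_setI]
  refine wp_loop_counted (fun s' => s'.ivar 16 ≤ n ∧ HoldsSegments L s' ∧
      ∀ i < s'.ivar 16, Normalized v w s' i)
    (fun s' => n - s'.ivar 16) 200 ?_ ?_ ?_
  · simpa [HoldsSegments, State.fst, State.snd] using hs
  · rintro s₁ hf ⟨hi, hs, hle⟩ hb
    have e3 : s₁.ivar 3 = n := by
      rw [hf.ivar 3 (by decide)]
      simp [hn]
    obtain ⟨e7, e8⟩ : s₁.rvar 7 = v.1 ∧ s₁.rvar 8 = v.2 := by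
      rw [hf.rvar 7 (by decide), hf.rvar 8 (by decide), ← hv]
      exact ⟨rfl, rfl⟩
    obtain ⟨e9, e10⟩ : s₁.rvar 9 = w.1 ∧ s₁.rvar 10 = w.2 := by
      rw [hf.rvar 9 (by decide), hf.rvar 10 (by decide), ← hw]
      exact ⟨rfl, rfl⟩
    simp only [Test.eval, IExpr.eval, e3] at hb
    set j := s₁.ivar 16 with hj
    rw [wp_seq, wp_cond]
    constructor
    · intro hc
      simp [alongExpr, e9, e10, ← hj] at hc
      simp [swapEndsCmd, alongExpr, ← hj, e7, e8, e9, e10]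
      refine ⟨⟨hb, fun i => ?_, fun i hi' => ?_⟩, by omega⟩
      · have := hs i
        by_cases hij : (i : ℕ) = j
        · simp [State.fst, State.snd, hij] at this ⊢
          tauto
        · simpa [State.fst, State.snd, hij] using this
      · rcases hi'.lt_or_eq with hi' | rfl
        · obtain ⟨h1, h2, h3, h4⟩ := hle i hi'
          constructor <;> simpa [State.fst, State.snd, hi'.ne]
        · constructor <;> simp [State.fst, State.snd, across, along, hc.le]
    · intro hc
      simp [alongExpr, e9, e10, ← hj] at hc
      simp [alongExpr, ← hj, e7, e8, e9, e10]
      refine ⟨⟨hb, fun i => ?_, fun i hi' => ?_⟩, by omega⟩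
      · simpa [State.fst, State.snd] using hs i
      · rcases hi'.lt_or_eq with hi' | rfl
        · obtain ⟨h1, h2, h3, h4⟩ := hle i hi'
          constructor <;> simpa [State.fst, State.snd, hi'.ne]
        · constructor <;> simp [State.fst, State.snd, across, along, hc]
  · rintro t s₁ hf ⟨hi, hs, hle⟩ hb ht
    have e3 : s₁.ivar 3 = n := by
      rw [hf.ivar 3 (by decide)]
      simp [hn]
    simp only [Test.eval, IExpr.eval, e3] at hb
    refine ⟨?_, hs, fun i hi' => hle i (by omega)⟩
    simp at ht ⊢
    omega

end RealRAM

/-! ### From hulls of end points to triangles on segments -/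

namespace RealRAM

variable {n : ℕ} {L : Fin n → Seg}

/-- The triangle `P` has its corners on the three different segments `I`, and `K` times its doubled
area is at least `f`. -/
def IsWitness (L : Fin n → Seg) (K f : ℝ) (I : ℕ × ℕ × ℕ) (P : (ℝ × ℝ) × (ℝ × ℝ) × (ℝ × ℝ)) : Prop :=
  ∃ i j k : Fin n, i ≠ j ∧ i ≠ k ∧ j ≠ k ∧ I = (↑i, ↑j, ↑k) ∧ P.1 ∈ (L i).carrier ∧
    P.2.1 ∈ (L j).carrier ∧ P.2.2 ∈ (L k).carrier ∧ f ≤ K * (2 * triArea P.1 P.2.1 P.2.2)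

theorem HoldsSegments.across_fst {s : State} (h : HoldsSegments L s) {v : ℝ × ℝ}
    (hv : ∀ i, across v (L i).p = across v (L i).q) (i : Fin n) :
    across v (s.fst i) = across v (L i).p := by
  rcases h i with ⟨h₁, -⟩ | ⟨h₁, -⟩ <;> rw [h₁]
  exact (hv i).symm

/-- A pass bounds the signed area of every triangle whose corners lie, in sorted order, on three
different segments. -/
theorem wp_passCmd_of_normalized {v w : ℝ × ℝ} (hw : w = v ∨ w = -v) {s : State}
    (hn : s.ivar 3 = n) (hL : HoldsSegments L s) (hv : ∀ i, across v (L i).p = across v (L i).q)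
    (hN : ∀ i < n, Normalized v w s i) (hperm : PermutesBelow n (s.iarr 0))
    (hsort : SortedTo (s.rarr 4) n n (s.iarr 0))
    (hs : Recorded (IsWitness L (v.1 ^ 2 + v.2 ^ 2)) s) (h0 : 0 ≤ s.rvar 0) :
    wp passCmd s fun t s' => t ≤ (2000 * n + 1000) * n + 10 ∧
      Recorded (IsWitness L (v.1 ^ 2 + v.2 ^ 2)) s' ∧ s.rvar 0 ≤ s'.rvar 0 ∧
      ∀ i j k : Fin n, ∀ p q r, p < q → q < r → r < n →
        s.iarr 0 p = i → s.iarr 0 q = j → s.iarr 0 r = k →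
        ∀ a ∈ (L i).carrier, ∀ b ∈ (L j).carrier, ∀ c ∈ (L k).carrier,
          (across v b - across v a) * (along w c - along w b) +
            (along w a - along w b) * (across v c - across v b) ≤ s'.rvar 0 := by
  have hmono : ∀ p q, p ≤ q → q < n →
      s.rarr 4 (s.iarr 0 p) ≤ s.rarr 4 (s.iarr 0 q) :=
    fun p q hpq hq => hsort p (by omega) q hpq hq
  have hacross : ∀ i < n, across v (s.fst i) = across v (s.snd i) :=
    fun i hi => hL.across_eq hv ⟨i, hi⟩
  refine wp_mono (wp_passCmd (W := IsWitness L (v.1 ^ 2 + v.2 ^ 2))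
    ⟨hn, rfl, rfl, rfl, rfl, rfl, rfl, rfl, rfl⟩ rfl rfl rfl hmono ?_ hs h0) ?_
  · intro p q r hpq hqr hr
    have hi := hperm.lt p (by omega)
    have hj := hperm.lt q (by omega)
    have hk := hperm.lt r hr
    have hne {p q : ℕ} (hpq : p < q) (hq : q < n) : s.iarr 0 p ≠ s.iarr 0 q :=
      fun h => hpq.ne (hperm.inj p (by omega) q hq h)
    refine ⟨⟨_, hi⟩, ⟨_, hj⟩, ⟨_, hk⟩, ?_, ?_, ?_, rfl, ?_, ?_, ?_, ?_⟩
    · simpa using hne hpq (by omega)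
    · simpa using hne (hpq.trans hqr) hr
    · simpa using hne hqr hr
    · rw [hL.carrier_eq]
      exact left_mem_segment ℝ _ _
    · rw [hL.carrier_eq]
      exact right_mem_segment ℝ _ _
    · rw [hL.carrier_eq]
      exact left_mem_segment ℝ _ _
    · change _ ≤ (v.1 ^ 2 + v.2 ^ 2) * (2 * triArea (s.fst (s.iarr 0 p)) (s.snd (s.iarr 0 q))
        (s.fst (s.iarr 0 r)))
      rw [← abs_area_coords]
      simp only [areaForm, Function.comp_apply, (hN _ hi).across_eq, (hN _ hj).across_eq,
        (hN _ hk).across_eq, (hN _ hi).along_fst, (hN _ hj).along_snd, (hN _ hk).along_fst,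
        hacross _ hj]
      -- For `w = v` the form is the quantity inside the absolute value, for `w = -v` its negative;
      -- the absolute value bounds both.
      rcases hw with rfl | rfl
      · exact le_abs_self _
      · refine le_trans (le_of_eq ?_) (neg_le_abs _)
        simp only [along_neg]
        ring
  · rintro t s' ⟨ht, hs', h₁, hle⟩
    refine ⟨ht, hs', h₁, ?_⟩
    intro i j k p q r hpq hqr hr hi hj hk a ha b hb c hc
    refine le_trans ?_ (hle p q r hpq hqr hr)
    have hpq' := hmono p q hpq.le (by omega)
    have hqr' := hmono q r hqr.le hr
    simp only [areaForm, Function.comp_apply, hi, hj, hk] at hpq' hqr' ⊢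
    have hNi := hN i i.2
    have hNj := hN j j.2
    have hNk := hN k k.2
    rw [hL.carrier_eq] at ha hb hc
    obtain ⟨a1, -, a2⟩ := across_eq_along_mem_of_mem_segment ha (hacross i i.2) hNi.le
    obtain ⟨b1, b2, -⟩ := across_eq_along_mem_of_mem_segment hb (hacross j j.2) hNj.le
    obtain ⟨c1, -, c2⟩ := across_eq_along_mem_of_mem_segment hc (hacross k k.2) hNk.le
    rw [a1, b1, c1, ← hNi.across_eq, ← hNj.across_eq, ← hNk.across_eq]
    rw [← hNi.along_fst] at a2
    rw [← hNj.along_snd] at b2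
    rw [← hNk.along_fst] at c2
    -- Sorting makes the coefficients nonnegative, so the form grows when the outer corners move to
    -- the upper ends and the middle corner to the lower end.
    exact add_le_add (mul_le_mul_of_nonneg_left (by linarith) (sub_nonneg.2 hpq'))
      (mul_le_mul_of_nonneg_right (by linarith) (sub_nonneg.2 hqr'))

/-! ### The whole program -/

/-- Record the first three segments, with the value zero. -/
def initCmd : Cmd :=
  .seq (.setR 0 (.const 0))
  (.seq (.setI 0 (.const 0))
  (.seq (.setI 1 (.const 1))
  (.seq (.setI 2 (.const 2))
  (.seq (.setR 1 (.get 0 (.const 0)))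
  (.seq (.setR 2 (.get 1 (.const 0)))
  (.seq (.setR 3 (.get 0 (.const 1)))
  (.seq (.setR 4 (.get 1 (.const 1)))
  (.seq (.setR 5 (.get 0 (.const 2)))
    (.setR 6 (.get 1 (.const 2)))))))))))

/-- Compute the area of the recorded triangle. -/
def outputCmd : Cmd :=
  .seq (.setR 13 (.sub
    (.mul (.sub (.var 3) (.var 1)) (.sub (.var 6) (.var 2)))
    (.mul (.sub (.var 5) (.var 1)) (.sub (.var 4) (.var 2)))))
  (.cond (.rlt (.var 13) (.const 0))
    (.setR 0 (.div (.sub (.const 0) (.var 13)) (.const 2)))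
    (.setR 0 (.div (.var 13) (.const 2))))

def maxMaxAreaCmd : Cmd :=
  .seq (.setI 3 (.var 0))
  (.seq directionCmd
  (.seq initCmd
  (.seq (.setR 9 (.var 7))
  (.seq (.setR 10 (.var 8))
  (.seq normalizeCmd
  (.seq sortCmd
  (.seq passCmd
  (.seq (.setR 9 (.sub (.const 0) (.var 7)))
  (.seq (.setR 10 (.sub (.const 0) (.var 8)))
  (.seq normalizeCmd
  (.seq passCmd outputCmd)))))))))))

theorem Recorded.congr {W : ℝ → ℕ × ℕ × ℕ → (ℝ × ℝ) × (ℝ × ℝ) × (ℝ × ℝ) → Prop} {s s' : State}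
    (h : Recorded W s) (hi : ∀ x < 3, s'.ivar x = s.ivar x) (hr : ∀ x < 7, s'.rvar x = s.rvar x) :
    Recorded W s' := by
  simpa [Recorded, hi, hr] using h

theorem HoldsSegments.congr {s s' : State} (h : HoldsSegments L s)
    (hr : ∀ x < 4, s'.rarr x = s.rarr x) : HoldsSegments L s' := by
  simpa [HoldsSegments, State.fst, State.snd, hr] using h

theorem Normalized.congr {v w : ℝ × ℝ} {i : ℕ} {s s' : State} (h : Normalized v w s i)
    (hr : s'.rarr = s.rarr) : Normalized v w s' i := by
  obtain ⟨h1, h2, h3, h4⟩ := h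
  constructor <;> simpa [State.fst, State.snd, hr]

/-- The second pass reuses the permutation of the first: exchanging the ends of a segment does not
change its coordinate across `v`. -/
theorem SortedTo.congr {X Y : ℕ → ℝ} {π : ℕ → ℕ} (h : SortedTo X n n π) (hπ : PermutesBelow n π)
    (hXY : ∀ i < n, X i = Y i) : SortedTo Y n n π := by
  intro a ha b hab hb
  rw [← hXY _ (hπ.lt a ha), ← hXY _ (hπ.lt b hb)]
  exact h a ha b hab hb

theorem wp_outputCmd {s : State} (W : ℕ × ℕ × ℕ → (ℝ × ℝ) × (ℝ × ℝ) × (ℝ × ℝ) → Prop)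
    (h : Recorded (fun _ => W) s) :
    wp outputCmd s fun t s' => t ≤ 60 ∧
      Recorded (fun f I P => W I P ∧ f = triArea P.1 P.2.1 P.2.2) s' := by
  have h' : W _ _ := h
  rw [outputCmd, wp_seq, wp_setR, wp_cond]
  constructor
  · intro hc
    simp at hc
    simp [Recorded, h', triArea]
    rw [abs_of_nonpos (by linarith)]
    ring
  · intro hc
    simp at hc
    simp [Recorded, h', triArea]
    rw [abs_of_nonneg (by linarith)]

/-- A triangle with corners on three different segments that is at least as large as every other
such triangle is a solution. -/
theorem isMaxMaxArea_of_forall_le {i j k : Fin n} (hij : i ≠ j) (hik : i ≠ k) (hjk : j ≠ k)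
    {a b c : ℝ × ℝ} (ha : a ∈ (L i).carrier) (hb : b ∈ (L j).carrier) (hc : c ∈ (L k).carrier)
    (hle : ∀ i' j' k' : Fin n, i' ≠ j' → i' ≠ k' → j' ≠ k' → ∀ a' ∈ (L i').carrier,
      ∀ b' ∈ (L j').carrier, ∀ c' ∈ (L k').carrier, triArea a' b' c' ≤ triArea a b c) :
    IsMaxMaxArea L (triArea a b c) := by
  constructor
  · let P : Fin n → ℝ × ℝ := Function.update (Function.update (Function.update
      (fun i => (L i).p) i a) j b) k c
    have hi : P i = a := by simp [P, hij, hik]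
    have hj : P j = b := by simp [P, hjk]
    have hk : P k = c := by simp [P]
    have hP : IsPlacement L P := by
      intro l
      by_cases hlk : l = k
      · rw [hlk, hk]
        exact hc
      by_cases hlj : l = j
      · rw [hlj, hj]
        exact hb
      by_cases hli : l = i
      · rw [hli, hi]
        exact ha
      · simp only [P, Function.update_of_ne, ne_eq, hlk, hlj, hli, not_false_eq_true]
        exact left_mem_segment ℝ _ _
    refine ⟨P, hP, ⟨i, j, k, hij, hik, hjk, by rw [hi, hj, hk]⟩, ?_⟩
    rintro _ ⟨i', j', k', h₁, h₂, h₃, rfl⟩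
    exact hle i' j' k' h₁ h₂ h₃ _ (hP i') _ (hP j') _ (hP k')
  · rintro _ ⟨P, hP, ⟨i', j', k', h₁, h₂, h₃, rfl⟩, -⟩
    exact hle i' j' k' h₁ h₂ h₃ _ (hP i') _ (hP j') _ (hP k')

/-- A bound for the triangles with corners in sorted order is a bound for all triangles. -/
theorem triArea_le_of_sorted {π : ℕ → ℕ} (hπ : PermutesBelow n π) {A : ℝ}
    (h : ∀ i j k : Fin n, ∀ p q r, p < q → q < r → r < n → π p = i → π q = j → π r = k →
      ∀ a ∈ (L i).carrier, ∀ b ∈ (L j).carrier, ∀ c ∈ (L k).carrier, triArea a b c ≤ A)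
    {i j k : Fin n} (hij : i ≠ j) (hik : i ≠ k) (hjk : j ≠ k)
    {a b c : ℝ × ℝ} (ha : a ∈ (L i).carrier) (hb : b ∈ (L j).carrier) (hc : c ∈ (L k).carrier) :
    triArea a b c ≤ A := by
  obtain ⟨p, hp, hpi⟩ := hπ.exists_eq i.2
  obtain ⟨q, hq, hqj⟩ := hπ.exists_eq j.2
  obtain ⟨r, hr, hrk⟩ := hπ.exists_eq k.2
  have hpq : p ≠ q := by
    rintro rfl
    exact hij (Fin.ext (hpi.symm.trans hqj))
  have hpr : p ≠ r := by
    rintro rfl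
    exact hik (Fin.ext (hpi.symm.trans hrk))
  have hqr : q ≠ r := by
    rintro rfl
    exact hjk (Fin.ext (hqj.symm.trans hrk))
  rcases hpq.lt_or_gt with h₁ | h₁ <;> rcases hpr.lt_or_gt with h₂ | h₂ <;>
    rcases hqr.lt_or_gt with h₃ | h₃
  · exact h _ _ _ p q r h₁ h₃ hr hpi hqj hrk a ha b hb c hc
  · rw [← triArea_swap_right]
    exact h _ _ _ p r q h₂ h₃ hq hpi hrk hqj a ha c hc b hb
  · omega
  · rw [← triArea_swap_right, ← triArea_swap_left]
    exact h _ _ _ r p q h₂ h₁ hq hrk hpi hqj c hc a ha b hb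
  · rw [← triArea_swap_left]
    exact h _ _ _ q p r h₁ h₂ hr hqj hpi hrk b hb a ha c hc
  · omega
  · rw [← triArea_swap_left, ← triArea_swap_right]
    exact h _ _ _ q r p h₃ h₂ hp hqj hrk hpi b hb c hc a ha
  · rw [← triArea_swap_left, ← triArea_swap_right, ← triArea_swap_left]
    exact h _ _ _ r q p h₃ h₁ hp hrk hqj hpi c hc b hb a ha

theorem wp_maxMaxAreaCmd (hn : 3 ≤ n) (hL : ParallelFamily L) :
    wp maxMaxAreaCmd (inputState L) fun t s => t ≤ 10000 * n ^ 2 ∧ HoldsSolution L s := by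
  rw [maxMaxAreaCmd, wp_seq, wp_setI, wp_seq]
  refine wp_frame (wp_mono (wp_directionCmd hL ?_ ?_ ?_) ?_)
  · simp [inputState]
  · intro i
    simp [State.fst, inputState]
  · intro i
    simp [State.snd, inputState]
  rintro t₁ s₁ ⟨ht₁, hv0, hv⟩ hf₁
  set v : ℝ × ℝ := (s₁.rvar 7, s₁.rvar 8) with hvdef
  have hn₁ : s₁.ivar 3 = n := by
    rw [hf₁.ivar 3 (by decide)]
    simp [inputState]
  have hL₁ : HoldsSegments L s₁ := by
    refine HoldsSegments.congr (s := inputState L) (fun i => .inl ?_)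
      fun x _ => hf₁.rarr x (by simp [directionCmd])
    simp [State.fst, State.snd, inputState]
  rw [wp_seq]
  refine wp_frame (wp_mono (R := fun t s => Frame initCmd s₁ s → _) (Q := fun t s => t ≤ 60 ∧
    s.rvar 0 = 0 ∧ Recorded (IsWitness L (v.1 ^ 2 + v.2 ^ 2)) s) ?_ ?_)
  · have key : ∀ i : Fin n, (s₁.rarr 0 i, s₁.rarr 1 i) ∈ (L i).carrier := fun i => by
      rw [hL₁.carrier_eq]
      exact left_mem_segment ℝ _ _
    simp only [initCmd, wp_seq, wp_setR, wp_setI]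
    refine ⟨by simp, by simp, ⟨0, by omega⟩, ⟨1, by omega⟩, ⟨2, by omega⟩, by simp, by simp,
      by simp, by simp, ?_, ?_, ?_, ?_⟩
    · simpa using key ⟨0, by omega⟩
    · simpa using key ⟨1, by omega⟩
    · simpa using key ⟨2, by omega⟩
    -- The initial value 0 need not match the area of the initial triangle, since `IsWitness` asks
    -- only for a lower bound. Its nonnegativity is what the clockwise argument needs.
    · simp only [rvar_setR]
      norm_num
      unfold triArea
      positivity
  rintro t₂ s₂ ⟨ht₂, hz₂, hs₂⟩ hf₂
  rw [wp_seq, wp_setR, wp_seq, wp_setR, wp_seq]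
  refine wp_frame (wp_mono (wp_normalizeCmd (L := L) (n := n) (v := v) (w := v) ?_ ?_ ?_ ?_) ?_)
  · simp [hf₂.ivar 3 (by decide), hn₁]
  · simp [hf₂.rvar 7 (by decide), hf₂.rvar 8 (by decide), hvdef]
  · simp [hf₂.rvar 7 (by decide), hf₂.rvar 8 (by decide), hvdef]
  · exact hL₁.congr fun x _ => hf₂.rarr x (by simp [initCmd])
  rintro t₃ s₃ ⟨ht₃, hL₃, hN₃⟩ hf₃
  have hn₃ : s₃.ivar 3 = n := by
    rw [hf₃.ivar 3 (by decide)]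
    simp [hf₂.ivar 3 (by decide), hn₁]
  have h7₃ : s₃.rvar 7 = v.1 := by
    rw [hf₃.rvar 7 (by decide)]
    simp [hf₂.rvar 7 (by decide), hvdef]
  have h8₃ : s₃.rvar 8 = v.2 := by
    rw [hf₃.rvar 8 (by decide)]
    simp [hf₂.rvar 8 (by decide), hvdef]
  have hr₃ : ∀ x < 7, s₃.rvar x = s₂.rvar x := fun x hx => by
    rw [hf₃.rvar x (by simp [normalizeCmd, swapEndsCmd]; omega)]
    simp [show x ≠ 9 ∧ x ≠ 10 by omega]
  have hi₃ : ∀ x < 3, s₃.ivar x = s₂.ivar x := fun x hx => by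
    rw [hf₃.ivar x (by simp [normalizeCmd, swapEndsCmd]; omega)]
    simp
  rw [wp_seq]
  refine wp_frame (wp_mono (wp_sortCmd hn₃) ?_)
  rintro t₄ s₄ ⟨ht₄, hperm, hsort⟩ hf₄
  have hrarr₄ : s₄.rarr = s₃.rarr :=
    funext fun x => hf₄.rarr x (by simp [sortCmd, selectCmd, swapCmd])
  have hrvar₄ : s₄.rvar = s₃.rvar :=
    funext fun x => hf₄.rvar x (by simp [sortCmd, selectCmd, swapCmd])
  have hn₄ : s₄.ivar 3 = n := (hf₄.ivar 3 (by decide)).trans hn₃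
  have hi₄ : ∀ x < 3, s₄.ivar x = s₃.ivar x := fun x hx =>
    hf₄.ivar x (by simp [sortCmd, selectCmd, swapCmd]; omega)
  have hL₄ : HoldsSegments L s₄ := hL₃.congr fun x _ => by rw [hrarr₄]
  rw [← hrarr₄] at hsort
  have hs₄ : Recorded (IsWitness L (v.1 ^ 2 + v.2 ^ 2)) s₄ :=
    hs₂.congr (fun x hx => (hi₄ x hx).trans (hi₃ x hx))
      fun x hx => by rw [hrvar₄, hr₃ x hx]
  have hz₄ : s₄.rvar 0 = 0 := by rw [hrvar₄, hr₃ 0 (by omega), hz₂]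
  rw [wp_seq]
  refine wp_frame (wp_mono (wp_passCmd_of_normalized (L := L) (v := v) (.inl rfl) hn₄ hL₄ hv
    (fun i hi => (hN₃ i hi).congr hrarr₄) hperm hsort hs₄ hz₄.ge) ?_)
  rintro t₅ s₅ ⟨ht₅, hs₅, hz₅, hle₅⟩ hf₅
  rw [hz₄] at hz₅
  have hn₅ : s₅.ivar 3 = n := (hf₅.ivar 3 (by decide)).trans hn₄
  have h7₅ : s₅.rvar 7 = v.1 := by rw [hf₅.rvar 7 (by decide), hrvar₄, h7₃]
  have h8₅ : s₅.rvar 8 = v.2 := by rw [hf₅.rvar 8 (by decide), hrvar₄, h8₃]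
  have hπ₅ : s₅.iarr 0 = s₄.iarr 0 := hf₅.iarr 0 (by decide)
  have hrarr₅ : s₅.rarr = s₄.rarr := funext fun x =>
    hf₅.rarr x (by simp [passCmd, hullCmd, insertCmd, popCmd, sweepCmd, advanceCmd, recordCmd])
  have hL₅ : HoldsSegments L s₅ := hL₄.congr fun x _ => by rw [hrarr₅]
  rw [wp_seq, wp_setR, wp_seq, wp_setR, wp_seq]
  refine wp_frame (wp_mono (wp_normalizeCmd (L := L) (n := n) (v := v) (w := -v) ?_ ?_ ?_ ?_) ?_)
  · simp [hn₅]
  · simp [h7₅, h8₅]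
  · simp [h7₅, h8₅, Prod.ext_iff]
  · exact hL₅.congr fun x _ => rfl
  rintro t₆ s₆ ⟨ht₆, hL₆, hN₆⟩ hf₆
  have hn₆ : s₆.ivar 3 = n := by
    rw [hf₆.ivar 3 (by decide)]
    simp [hn₅]
  have hr₆ : ∀ x < 7, s₆.rvar x = s₅.rvar x := fun x hx => by
    rw [hf₆.rvar x (by simp [normalizeCmd, swapEndsCmd]; omega)]
    simp [show x ≠ 9 ∧ x ≠ 10 by omega]
  have hi₆ : ∀ x < 3, s₆.ivar x = s₅.ivar x := fun x hx => by
    rw [hf₆.ivar x (by simp [normalizeCmd, swapEndsCmd]; omega)]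
    simp
  have hπ₆ : s₆.iarr 0 = s₄.iarr 0 := by
    rw [hf₆.iarr 0 (by decide)]
    simp [hπ₅]
  have hz₆ : s₆.rvar 0 = s₅.rvar 0 := hr₆ 0 (by omega)
  rw [← hπ₆] at hperm hsort
  have hsort₆ : SortedTo (s₆.rarr 4) n n (s₆.iarr 0) := hsort.congr hperm fun i hi => by
    rw [hrarr₄, (hN₃ i hi).across_eq, (hN₆ i hi).across_eq, hL₃.across_fst hv ⟨i, hi⟩,
      hL₆.across_fst hv ⟨i, hi⟩]
  rw [wp_seq]
  refine wp_mono (wp_passCmd_of_normalized (L := L) (v := v) (.inr rfl) hn₆ hL₆ hv hN₆ hperm hsort₆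
    (hs₅.congr hi₆ hr₆) (by rwa [hz₆])) ?_
  rintro t₇ s₇ ⟨ht₇, hs₇, hz₇, hle₇⟩
  rw [hz₆] at hz₇
  refine wp_mono (wp_outputCmd _ (s := s₇) hs₇) ?_
  rintro t₈ s₈ ⟨ht₈, ⟨i, j, k, hij, hik, hjk, hI, ha, hb, hc, hf⟩, harea⟩
  simp only at ha hb hc hf harea
  simp only [Prod.mk.injEq] at hI
  refine ⟨?_, ?_, i, j, k, hij, hik, hjk, hI.1, hI.2.1, hI.2.2, ha, hb, hc, harea.symm⟩
  · simp
    -- The hypothesis `3 ≤ n` lets the quadratic term absorb the linear and constant ones.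
    nlinarith
  · have hK : 0 < v.1 ^ 2 + v.2 ^ 2 := by
      rw [Ne, Prod.ext_iff, not_and_or] at hv0
      rcases hv0 with h | h
      · have : 0 < v.1 ^ 2 := sq_pos_of_ne_zero h
        positivity
      · have : 0 < v.2 ^ 2 := sq_pos_of_ne_zero h
        positivity
    rw [harea]
    refine isMaxMaxArea_of_forall_le hij hik hjk ha hb hc ?_
    intro i' j' k' hij' hik' hjk' a' ha' b' hb' c' hc'
    refine triArea_le_of_sorted hperm ?_ hij' hik' hjk' ha' hb' hc'
    intro i j k p q r hpq hqr hr hi hj hk a ha b hb c hc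
    have h₁ := hle₅ i j k p q r hpq hqr hr (by rw [← hπ₆, hi]) (by rw [← hπ₆, hj])
      (by rw [← hπ₆, hk]) a ha b hb c hc
    have h₂ := hle₇ i j k p q r hpq hqr hr hi hj hk a ha b hb c hc
    simp only [along_neg] at h₂
    have h₃ := abs_area_coords v a b c
    have h₄ : (v.1 ^ 2 + v.2 ^ 2) * (2 * triArea a b c) ≤ s₇.rvar 0 := by
      rw [← h₃]
      -- The first pass bounds the form, the second its negative, and the recorded value never
      -- decreases.
      exact abs_le'.2 ⟨h₁.trans hz₇, by linarith⟩
    -- The recorded value lies between the scaled doubled area of an arbitrary competitor and that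
    -- of the recorded triangle.
    have h₅ := le_of_mul_le_mul_left (h₄.trans hf) hK
    linarith

end RealRAM

/-- MaxMaxArea for `n` parallel segments of arbitrary lengths can be solved in `O(n ^ 2)` time: one
program for the real RAM solves all instances, within a constant times `n ^ 2` steps. -/
theorem mainTheorem2 :
    ∃ (prog : RealRAM.Cmd) (C : ℕ),
      ∀ (n : ℕ), 3 ≤ n → ∀ (L : Fin n → Seg), ParallelFamily L →
        ∃ (t : ℕ) (s : RealRAM.State),
          RealRAM.Exec prog (inputState L) t s ∧ t ≤ C * n ^ 2 ∧ HoldsSolution L s :=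
  ⟨RealRAM.maxMaxAreaCmd, 10000, fun _ hn _ hL => RealRAM.wp_maxMaxAreaCmd hn hL⟩
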